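/- Let $F$ be a field of characteristic $\neq 2$, let $\upsilon\in F^\times$, put $q=\upsilon^2$, and assume that $q\neq 1$ is a primitive $l$-th root of unity ($l\ge 1$). Let $r\ge 1$. **Notation.** For a commutative ring $R$ and $q\in R^\times$, let $\mathcal H_R$ be the Hecke algebra of the symmetric group $W=\mathfrak S_r$: it is free over $R$ with basis $(T_w)_{w\in W}$, and $T_wT_s=T_{ws}$ if $\ell(ws)>\ell(w)$ and $T_wT_s=(q-1)T_w+qT_{ws}$ otherwise, for every basic transposition $s$. For $0\le a\le r$ let $x_a=\sum_{w}T_w$, where $w$ runs over the permutations of $\{1,\dots,a\}$, and $y_a=\sum_w(-q)^{-\ell(w)}T_w$, where $w$ runs over the permutations of $\{a+1,\dots,r\}$. Put $$\mathcal E_R(1|1,r)=\mathrm{End}_{\mathcal H_R}\Big(\bigoplus_{a=0}^r x_ay_a\mathcal H_R\Big),$$ the endomorphism algebra of a right $\mathcal H_R$-module. Let $\mathcal Z=\mathbb Z[\boldsymbol\upsilon,\boldsymbol\upsilon^{-1}]$ with the parameter $\boldsymbol\upsilon^2$, let $\mathcal S(1|1,r)=\mathcal E_{\mathcal Z}(1|1,r)$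 be the generic $q$-Schur superalgebra, and let $\mathcal S_F(1|1,r)=F\otimes_{\mathcal Z}\mathcal S(1|1,r)$, where $F$ is a $\mathcal Z$-algebra via $\boldsymbol\upsilon\mapsto\upsilon$. **Statement.** 1. If $l\nmid r$, then $\mathcal S_F(1|1,r)$ is semisimple, it has exactly $r$ simple modules up to isomorphism, and all of them have dimension $2$ over $F$. 2. If $l\mid r$, then $\mathcal S_F(1|1,r)$ is not semisimple, it has exactly $r+1$ simple modules up to isomorphism, and all of them have dimension $1$ over $F$. Moreover, if $q\neq -1$ (that is, $l\neq 2$), then 1 and 2 also hold with the endomorphism algebra $\mathcal E_F(1|1,r)$, formed over $F$ itself with the parameter $q$, in place of $\mathcal S_F(1|1,r)$. -/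

import Mathlib

open scoped TensorProduct

noncomputable section

namespace QSchur

/-! ### The symmetric group: basic transpositions and length -/

/-- The letter `k` among the letters `0, …, r - 1`. -/
def lo {r : ℕ} (k : Fin (r - 1)) : Fin r := ⟨k, by omega⟩

/-- The letter `k + 1` among the letters `0, …, r - 1`. -/
def hi {r : ℕ} (k : Fin (r - 1)) : Fin r := ⟨k + 1, by omega⟩

/-- The basic transposition exchanging the letters `k` and `k + 1` (letters are numbered from `0`). -/
def simpleRefl {r : ℕ} (k : Fin (r - 1)) : Equiv.Perm (Fin r) :=
  Equiv.swap (lo k) (hi k)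

/-- The length of `w`: the least length of a word in the basic transpositions with product `w`. -/
def length {r : ℕ} (w : Equiv.Perm (Fin r)) : ℕ :=
  sInf {n | ∃ ks : List (Fin (r - 1)), ks.length = n ∧ (ks.map simpleRefl).prod = w}

/-- The inversions of `w`; an auxiliary notion used to compute lengths. -/
def invSet {r : ℕ} (w : Equiv.Perm (Fin r)) : Finset (Fin r × Fin r) :=
  Finset.univ.filter fun p => p.1 < p.2 ∧ w p.2 < w p.1

theorem mem_invSet {r : ℕ} (w : Equiv.Perm (Fin r)) (a b : Fin r) :
    (a, b) ∈ invSet w ↔ a < b ∧ w b < w a := by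
  simp [invSet]

theorem invSet_one {r : ℕ} : invSet (1 : Equiv.Perm (Fin r)) = ∅ := by
  ext ⟨a, b⟩
  rw [mem_invSet]
  simpa using fun h : a < b => h.le

theorem lo_lt_hi {r : ℕ} (k : Fin (r - 1)) : lo k < hi k := by
  simp [lo, hi, Fin.lt_def]

theorem simpleRefl_mul_self {r : ℕ} (k : Fin (r - 1)) : simpleRefl k * simpleRefl k = 1 :=
  Equiv.swap_mul_self _ _

theorem simpleRefl_apply {r : ℕ} (k : Fin (r - 1)) (a : Fin r) :
    ((simpleRefl k a : Fin r) : ℕ) =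
      if (a : ℕ) = k then (k : ℕ) + 1 else if (a : ℕ) = k + 1 then (k : ℕ) else a := by
  unfold simpleRefl
  rw [Equiv.swap_apply_def]
  simp only [Fin.ext_iff, lo, hi]
  split_ifs <;> simp_all

theorem invSet_card_of_lt {r : ℕ} (w : Equiv.Perm (Fin r)) (k : Fin (r - 1))
    (h : w (lo k) < w (hi k)) :
    (invSet (w * simpleRefl k)).card = (invSet w).card + 1 := by
  classical
  set s := simpleRefl k with hs
  have hss : ∀ a, s (s a) = a := fun a => by
    have := simpleRefl_mul_self k
    rw [← hs] at this
    rw [← Equiv.Perm.mul_apply, this, Equiv.Perm.one_apply]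
  have hlt : ∀ a b : Fin r, a < b → ¬ ((a : ℕ) = k ∧ (b : ℕ) = k + 1) → s a < s b := by
    intro a b hab hne
    rw [Fin.lt_def] at hab ⊢
    rw [hs, simpleRefl_apply, simpleRefl_apply]
    split_ifs <;> omega
  have hk0 : s (lo k) = (hi k) := Equiv.swap_apply_left _ _
  have hk1 : s (hi k) = (lo k) := Equiv.swap_apply_right _ _
  have hset : invSet (w * s) =
      insert (((lo k), (hi k)) : Fin r × Fin r)
        ((invSet w).image fun p => (s p.1, s p.2)) := by
    ext ⟨a, b⟩
    simp only [mem_invSet, Finset.mem_insert,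
      Finset.mem_image, Prod.mk.injEq, Prod.exists, Equiv.Perm.mul_apply]
    constructor
    · rintro ⟨hab, hw⟩
      by_cases hc : (a : ℕ) = k ∧ (b : ℕ) = k + 1
      · left
        exact ⟨Fin.ext hc.1, Fin.ext hc.2⟩
      · right
        exact ⟨s a, s b, ⟨hlt a b hab hc, hw⟩, hss a, hss b⟩
    · rintro (⟨rfl, rfl⟩ | ⟨c, d, ⟨hcd, hw⟩, rfl, rfl⟩)
      · refine ⟨lo_lt_hi k, ?_⟩
        rw [hk0, hk1]; exact h
      · rw [hss, hss]
        refine ⟨hlt c d hcd ?_, hw⟩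
        rintro ⟨h1, h2⟩
        have e1 : c = (lo k) := Fin.ext h1
        have e2 : d = (hi k) := Fin.ext h2
        rw [e1, e2] at hw
        exact lt_asymm h hw
  rw [hset, Finset.card_insert_of_notMem, Finset.card_image_of_injective]
  · rintro ⟨a, b⟩ ⟨c, d⟩ he
    simpa using he
  · simp only [Finset.mem_image, mem_invSet,
      Prod.mk.injEq, Prod.exists, not_exists]
    rintro c d ⟨⟨hcd, -⟩, h1, h2⟩
    have e1 : c = (hi k) := by rw [← hss c, h1, hk0]
    have e2 : d = (lo k) := by rw [← hss d, h2, hk1]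
    rw [e1, e2] at hcd
    exact lt_asymm hcd (lo_lt_hi k)

theorem apply_ne {r : ℕ} (w : Equiv.Perm (Fin r)) (k : Fin (r - 1)) :
    w (lo k) ≠ w (hi k) := by
  intro h
  exact (lo_lt_hi k).ne (w.injective h)

theorem invSet_card_of_gt {r : ℕ} (w : Equiv.Perm (Fin r)) (k : Fin (r - 1))
    (h : w (hi k) < w (lo k)) :
    (invSet (w * simpleRefl k)).card + 1 = (invSet w).card := by
  have := invSet_card_of_lt (w * simpleRefl k) k (by
    have hk0 : simpleRefl k (lo k) = (hi k) := Equiv.swap_apply_left _ _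
    have hk1 : simpleRefl k (hi k) = (lo k) := Equiv.swap_apply_right _ _
    rw [Equiv.Perm.mul_apply, Equiv.Perm.mul_apply, hk0, hk1]
    exact h)
  rw [mul_assoc, simpleRefl_mul_self, mul_one] at this
  exact this.symm

theorem exists_descent {r : ℕ} (w : Equiv.Perm (Fin r)) (hw : w ≠ 1) :
    ∃ k : Fin (r - 1), w (hi k) < w (lo k) := by
  by_contra! hcon
  apply hw
  obtain _ | n := r
  · exact Subsingleton.elim _ _
  have hmono : StrictMono w := by
    rw [Fin.strictMono_iff_lt_succ]
    intro i
    exact lt_of_le_of_ne (hcon ⟨i, i.2⟩) (apply_ne w ⟨i, i.2⟩)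
  have h1 : (hmono.orderIsoOfSurjective w w.surjective) = OrderIso.refl _ := Subsingleton.elim _ _
  ext a
  have := congrArg (fun e : Fin (n + 1) ≃o Fin (n + 1) => e a) h1
  simpa using congrArg Fin.val this

theorem exists_word {r : ℕ} (n : ℕ) : ∀ w : Equiv.Perm (Fin r), (invSet w).card = n →
    ∃ ks : List (Fin (r - 1)), ks.length = n ∧ (ks.map simpleRefl).prod = w := by
  induction n with
  | zero =>
    intro w hw
    refine ⟨[], rfl, ?_⟩
    by_contra hne
    obtain ⟨k, hk⟩ := exists_descent w (fun h => hne (by simp [h]))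
    have := invSet_card_of_gt w k hk
    omega
  | succ n ih =>
    intro w hw
    have hne : w ≠ 1 := by
      rintro rfl
      simp [invSet_one] at hw
    obtain ⟨k, hk⟩ := exists_descent w hne
    have h1 := invSet_card_of_gt w k hk
    obtain ⟨ks, hl, hp⟩ := ih (w * simpleRefl k) (by omega)
    refine ⟨ks ++ [k], by simp [hl], ?_⟩
    rw [List.map_append, List.prod_append, hp]
    simp [mul_assoc, simpleRefl_mul_self]

theorem invSet_card_word_le {r : ℕ} (ks : List (Fin (r - 1))) :
    (invSet (ks.map simpleRefl).prod).card ≤ ks.length := by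
  induction ks using List.reverseRecOn with
  | nil =>
    simp [invSet_one]
  | append_singleton ks k ih =>
    rw [List.map_append, List.prod_append]
    simp only [List.map_cons, List.map_nil, List.prod_singleton, List.length_append,
      List.length_singleton]
    rcases lt_or_gt_of_ne (apply_ne (ks.map simpleRefl).prod k) with h | h
    · rw [invSet_card_of_lt _ k h]; omega
    · have := invSet_card_of_gt _ k h; omega

theorem length_eq {r : ℕ} (w : Equiv.Perm (Fin r)) : length w = (invSet w).card := by
  apply le_antisymm
  · exact Nat.sInf_le (exists_word _ w rfl)
  · have hne : {n | ∃ ks : List (Fin (r - 1)), ks.length = n ∧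
        (ks.map simpleRefl).prod = w}.Nonempty := ⟨_, exists_word _ w rfl⟩
    obtain ⟨ks, hl, hp⟩ := Nat.sInf_mem hne
    rw [length, ← hl, ← hp]
    exact invSet_card_word_le ks

theorem length_lt_mul_iff {r : ℕ} (w : Equiv.Perm (Fin r)) (k : Fin (r - 1)) :
    length w < length (w * simpleRefl k) ↔ w (lo k) < w (hi k) := by
  rw [length_eq, length_eq]
  rcases lt_or_gt_of_ne (apply_ne w k) with h | h
  · simp [invSet_card_of_lt w k h, h]
  · have := invSet_card_of_gt w k h
    have h2 := lt_asymm h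
    constructor
    · intro h3; omega
    · intro h3; exact absurd h3 h2

theorem length_inv {r : ℕ} (w : Equiv.Perm (Fin r)) : length w⁻¹ = length w := by
  have key : ∀ v : Equiv.Perm (Fin r), length v⁻¹ ≤ length v := by
    intro v
    obtain ⟨ks, hl, hp⟩ := exists_word _ v rfl
    rw [length_eq v, ← hl]
    refine Nat.sInf_le ⟨ks.reverse, by simp, ?_⟩
    rw [← hp, List.prod_inv_reverse, List.map_map, List.map_reverse]
    congr 2
  apply le_antisymm (key w)
  simpa using key w⁻¹

theorem length_lt_simpleRefl_mul_iff {r : ℕ} (w : Equiv.Perm (Fin r)) (k : Fin (r - 1)) :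
    length w < length (simpleRefl k * w) ↔ w⁻¹ (lo k) < w⁻¹ (hi k) := by
  rw [← length_lt_mul_iff, length_inv, ← length_inv (simpleRefl k * w), mul_inv_rev,
    inv_eq_of_mul_eq_one_left (simpleRefl_mul_self k)]

/-! ### The Hecke algebra -/

section Hecke

variable (R : Type*) [CommRing R] (q : Rˣ) (r : ℕ)

/-- The right multiplication by `T_s`, `s` a basic transposition, on the free module with basis
`(T_w)`: it sends `T_w` to `T_{ws}` if `ℓ(ws) > ℓ(w)` and to `(q - 1) T_w + q T_{ws}` otherwise. -/
def rightOp (k : Fin (r - 1)) :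
    (Equiv.Perm (Fin r) → R) →ₗ[R] (Equiv.Perm (Fin r) → R) :=
  (Pi.basisFun R (Equiv.Perm (Fin r))).constr R fun w =>
    if length w < length (w * simpleRefl k) then Pi.single (w * simpleRefl k) 1
    else ((q : R) - 1) • Pi.single w 1 + (q : R) • Pi.single (w * simpleRefl k) 1

/-- The left multiplication by `T_s`; an auxiliary operator. -/
def leftOp (k : Fin (r - 1)) :
    (Equiv.Perm (Fin r) → R) →ₗ[R] (Equiv.Perm (Fin r) → R) :=
  (Pi.basisFun R (Equiv.Perm (Fin r))).constr R fun w =>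
    if length w < length (simpleRefl k * w) then Pi.single (simpleRefl k * w) 1
    else ((q : R) - 1) • Pi.single w 1 + (q : R) • Pi.single (simpleRefl k * w) 1

/-- The Hecke algebra of the symmetric group on `r` letters, realised on its right regular
module: it is the algebra of all linear operators on the free module with basis `(T_w)` that commute
with the right multiplications by the `T_s`. Its basis `HeckeAlgebra.basis` and the theorems
`HeckeAlgebra.T_one` and `HeckeAlgebra.T_mul_T` below show that it is the free module with basis
`(T_w)` and the defining multiplication rule. -/
def HeckeAlgebra : Type _ :=
  (Subalgebra.centralizer R (Set.range (rightOp R q r)) :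
    Subalgebra R (Module.End R (Equiv.Perm (Fin r) → R)))

instance : Ring (HeckeAlgebra R q r) :=
  inferInstanceAs (Ring (Subalgebra.centralizer R (Set.range (rightOp R q r)) :
    Subalgebra R (Module.End R (Equiv.Perm (Fin r) → R))))

instance : Algebra R (HeckeAlgebra R q r) :=
  inferInstanceAs (Algebra R (Subalgebra.centralizer R (Set.range (rightOp R q r)) :
    Subalgebra R (Module.End R (Equiv.Perm (Fin r) → R))))

namespace HeckeAlgebra

variable {R r}

theorem rightOp_single (k : Fin (r - 1)) (w : Equiv.Perm (Fin r)) :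
    rightOp R q r k (Pi.single w 1) =
    if length w < length (w * simpleRefl k) then Pi.single (w * simpleRefl k) 1
    else ((q : R) - 1) • Pi.single w 1 + (q : R) • Pi.single (w * simpleRefl k) 1 := by
  rw [rightOp, ← Pi.basisFun_apply R, Module.Basis.constr_basis, Pi.basisFun_apply]

theorem leftOp_single (k : Fin (r - 1)) (w : Equiv.Perm (Fin r)) :
    leftOp R q r k (Pi.single w 1) =
    if length w < length (simpleRefl k * w) then Pi.single (simpleRefl k * w) 1
    else ((q : R) - 1) • Pi.single w 1 + (q : R) • Pi.single (simpleRefl k * w) 1 := by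
  rw [leftOp, ← Pi.basisFun_apply R, Module.Basis.constr_basis, Pi.basisFun_apply]

theorem right_iff (j k : Fin (r - 1)) (w : Equiv.Perm (Fin r))
    (h : simpleRefl j * w ≠ w * simpleRefl k) :
    (length (simpleRefl j * w) < length (simpleRefl j * w * simpleRefl k) ↔
      length w < length (w * simpleRefl k)) := by
  rw [length_lt_mul_iff, length_lt_mul_iff, Equiv.Perm.mul_apply, Equiv.Perm.mul_apply]
  set a := w (lo k) with ha
  set b := w (hi k) with hb
  have hab : a ≠ b := apply_ne w k
  have hne : ∀ x y : Fin r, (x = a ∧ y = b ∨ x = b ∧ y = a) →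
      ¬ ((x : ℕ) = j ∧ (y : ℕ) = j + 1) := by
    rintro x y hxy ⟨h1, h2⟩
    apply h
    have hx : x = (lo j) := Fin.ext h1
    have hy : y = (hi j) := Fin.ext h2
    have h3 : simpleRefl j = Equiv.swap a b := by
      rcases hxy with ⟨rfl, rfl⟩ | ⟨rfl, rfl⟩
      · exact (congrArg₂ Equiv.swap hx hy).symm
      · exact (congrArg₂ Equiv.swap hx hy).symm.trans (Equiv.swap_comm _ _)
    rw [h3, ha, hb, Equiv.swap_apply_apply]
    simp only [simpleRefl, mul_assoc, inv_mul_cancel, mul_one]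
  have h1 := hne a b (Or.inl ⟨rfl, rfl⟩)
  have h2 := hne b a (Or.inr ⟨rfl, rfl⟩)
  have h3 : (a : ℕ) ≠ b := fun h => hab (Fin.ext h)
  rw [Fin.lt_def, Fin.lt_def, simpleRefl_apply, simpleRefl_apply]
  split_ifs <;> omega

theorem left_iff (j k : Fin (r - 1)) (w : Equiv.Perm (Fin r))
    (h : simpleRefl j * w ≠ w * simpleRefl k) :
    (length (w * simpleRefl k) < length (simpleRefl j * (w * simpleRefl k)) ↔
      length w < length (simpleRefl j * w)) := by
  have hi : ∀ i : Fin (r - 1), (simpleRefl i)⁻¹ = simpleRefl i := fun i =>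
    inv_eq_of_mul_eq_one_left (simpleRefl_mul_self i)
  have := right_iff k j w⁻¹ (fun h' => h (by
    have := congrArg (fun g => g⁻¹) h'
    simpa [mul_inv_rev, hi] using this.symm))
  rw [← length_inv (w * simpleRefl k), ← length_inv (simpleRefl j * (w * simpleRefl k)),
    ← length_inv w, ← length_inv (simpleRefl j * w)]
  simpa only [mul_inv_rev, hi] using this

theorem leftOp_comm (j k : Fin (r - 1)) :
    rightOp R q r k * leftOp R q r j = leftOp R q r j * rightOp R q r k := by
  apply (Pi.basisFun R (Equiv.Perm (Fin r))).ext
  intro w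
  rw [Pi.basisFun_apply, Module.End.mul_apply, Module.End.mul_apply]
  by_cases h : simpleRefl j * w = w * simpleRefl k
  · have e : simpleRefl j * w * simpleRefl k = w := by
      rw [h, mul_assoc, simpleRefl_mul_self, mul_one]
    have e' : simpleRefl j * (w * simpleRefl k) = w := by
      rw [← h, ← mul_assoc, simpleRefl_mul_self, one_mul]
    rw [leftOp_single, rightOp_single, h]
    split_ifs with hc <;>
    · simp only [map_add, map_smul, leftOp_single, rightOp_single, e', h, mul_assoc,
        simpleRefl_mul_self, mul_one]
  · have h1 := right_iff j k w h
    have h2 := left_iff j k w h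
    rw [mul_assoc] at h1
    by_cases hl : length w < length (simpleRefl j * w) <;>
    by_cases hr : length w < length (w * simpleRefl k) <;>
    simp only [hl, hr, iff_true, iff_false] at h1 h2 <;>
    simp only [leftOp_single, rightOp_single, hl, hr, h1, h2, if_true, if_false, map_add,
      map_smul, mul_assoc] <;>
    module

/-- The value of an element of the Hecke algebra at the basis vector `T_1`. -/
def evalOne : HeckeAlgebra R q r →ₗ[R] (Equiv.Perm (Fin r) → R) where
  toFun f := f.1 (Pi.single 1 1)
  map_add' _ _ := rfl
  map_smul' _ _ := rfl

theorem comm_rightOp (f : HeckeAlgebra R q r) (k : Fin (r - 1)) (v : Equiv.Perm (Fin r) → R) :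
    f.1 (rightOp R q r k v) =
      rightOp R q r k (f.1 v) := by
  have := (Subalgebra.mem_centralizer_iff R).1 f.2 _ ⟨k, rfl⟩
  exact (congrArg (fun g : Module.End R (Equiv.Perm (Fin r) → R) => g v) this).symm

theorem exists_descent_decomp (w : Equiv.Perm (Fin r)) (hw : w ≠ 1) :
    ∃ (v : Equiv.Perm (Fin r)) (k : Fin (r - 1)),
      w = v * simpleRefl k ∧ length v < length (v * simpleRefl k) := by
  obtain ⟨k, hk⟩ := exists_descent w hw
  refine ⟨w * simpleRefl k, k, by rw [mul_assoc, simpleRefl_mul_self, mul_one], ?_⟩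
  rw [mul_assoc, simpleRefl_mul_self, mul_one, length_eq, length_eq]
  have := invSet_card_of_gt w k hk
  omega

theorem evalOne_injective : Function.Injective (evalOne (R := R) (r := r) q) := by
  rw [injective_iff_map_eq_zero]
  intro f hf
  have key : ∀ n : ℕ, ∀ w : Equiv.Perm (Fin r), length w = n →
      f.1 (Pi.single w 1) = 0 := by
    intro n
    induction n using Nat.strong_induction_on with
    | _ n ih =>
      intro w hn
      by_cases hw : w = 1
      · rw [hw]; exact hf
      · obtain ⟨v, k, rfl, hlt⟩ := exists_descent_decomp w hw
        have h1 := ih (length v) (by omega) v rfl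
        have h2 := comm_rightOp q f k (Pi.single v 1)
        rw [h1, map_zero, rightOp_single, if_pos hlt] at h2
        exact h2
  apply Subtype.ext
  apply (Pi.basisFun R (Equiv.Perm (Fin r))).ext
  intro w
  rw [Pi.basisFun_apply]
  exact key _ w rfl

theorem leftOp_mem (k : Fin (r - 1)) :
    leftOp R q r k ∈ Subalgebra.centralizer R (Set.range (rightOp R q r)) := by
  rw [Subalgebra.mem_centralizer_iff]
  rintro _ ⟨j, rfl⟩
  exact leftOp_comm q k j

theorem evalOne_surjective : Function.Surjective (evalOne (R := R) (r := r) q) := by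
  have key : ∀ n : ℕ, ∀ w : Equiv.Perm (Fin r), length w = n →
      ∃ f, evalOne (R := R) (r := r) q f = Pi.single w 1 := by
    intro n
    induction n using Nat.strong_induction_on with
    | _ n ih =>
      intro w hn
      by_cases hw : w = 1
      · exact ⟨1, by rw [hw]; rfl⟩
      · obtain ⟨v, k, hv, hlt⟩ := exists_descent_decomp w⁻¹ (inv_ne_one.2 hw)
        have hk : (simpleRefl k)⁻¹ = simpleRefl k :=
          inv_eq_of_mul_eq_one_left (simpleRefl_mul_self k)
        have hw' : w = simpleRefl k * v⁻¹ := by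
          rw [← inv_inv w, hv, mul_inv_rev, hk]
        have hlt' : length v⁻¹ < length (simpleRefl k * v⁻¹) := by
          rw [← length_inv (simpleRefl k * v⁻¹), mul_inv_rev, inv_inv, hk, length_inv]
          exact hlt
        obtain ⟨f, hf⟩ := ih (length v⁻¹) (by rw [hw'] at hn; omega) v⁻¹ rfl
        let g : HeckeAlgebra R q r := ⟨leftOp R q r k, leftOp_mem q k⟩
        refine ⟨g * f, ?_⟩
        have : evalOne (R := R) (r := r) q (g * f) =
          leftOp R q r k (evalOne (R := R) (r := r) q f) := rfl
        rw [this, hf, leftOp_single, if_pos hlt', hw']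
  intro v
  choose g hg using fun w => key _ w rfl
  refine ⟨∑ w, v w • g w, ?_⟩
  conv_rhs => rw [pi_eq_sum_univ' v]
  rw [map_sum]
  exact Finset.sum_congr rfl fun w _ => by rw [map_smul, hg]

/-- The basis `(T_w)` of the Hecke algebra. -/
def basis : Module.Basis (Equiv.Perm (Fin r)) R (HeckeAlgebra R q r) :=
  Module.Basis.ofEquivFun
    (LinearEquiv.ofBijective (evalOne q) ⟨evalOne_injective q, evalOne_surjective q⟩)

/-- The basis element `T_w` of the Hecke algebra. -/
def T (w : Equiv.Perm (Fin r)) : HeckeAlgebra R q r := basis q w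

theorem evalOne_T (w : Equiv.Perm (Fin r)) :
    evalOne (R := R) (r := r) q (T q w) = Pi.single w 1 := by
  rw [T, basis, Module.Basis.coe_ofEquivFun]
  exact LinearEquiv.apply_symm_apply (LinearEquiv.ofBijective (evalOne (R := R) (r := r) q)
    ⟨evalOne_injective q, evalOne_surjective q⟩) _

theorem T_one : T (R := R) (r := r) q 1 = 1 :=
  evalOne_injective q (evalOne_T q 1)

/-- The multiplication rule of the Hecke algebra. -/
theorem T_mul_T (w : Equiv.Perm (Fin r)) (k : Fin (r - 1)) :
    T (R := R) q w * T q (simpleRefl k) =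
      if length w < length (w * simpleRefl k) then T q (w * simpleRefl k)
      else ((q : R) - 1) • T q w + (q : R) • T q (w * simpleRefl k) := by
  apply evalOne_injective q
  have h1 : rightOp R q r k (Pi.single 1 1) = Pi.single (simpleRefl k) 1 := by
    rw [rightOp_single, one_mul, if_pos]
    have := (length_lt_mul_iff (1 : Equiv.Perm (Fin r)) k).2 (lo_lt_hi k)
    simpa using this
  have h2 : evalOne (R := R) (r := r) q (T q w * T q (simpleRefl k)) =
      (T (R := R) q w).1
        (evalOne q (T q (simpleRefl k))) := rfl
  rw [h2, evalOne_T, ← h1, comm_rightOp]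
  have h3 : (T (R := R) q w).1 (Pi.single 1 1) =
    Pi.single w 1 := evalOne_T q w
  rw [h3, rightOp_single]
  split_ifs
  · rw [evalOne_T]
  · rw [map_add, map_smul, map_smul, evalOne_T, evalOne_T]

end HeckeAlgebra

end Hecke

/-! ### Compositions and parabolic subgroups -/

/-- `Λ(m|n, r)`: the sequences of `m + n` natural numbers with sum `r`; the first `m` entries are
the even part `λ⁽⁰⁾` and the last `n` entries are the odd part `λ⁽¹⁾`. -/
def SuperComposition (m n r : ℕ) : Type := {a : Fin (m + n) → ℕ // ∑ i, a i = r}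

/-- The `i`-th block of letters of a composition: `λ_i` consecutive letters, which come after the
letters of the blocks with smaller index. -/
def block {m n r : ℕ} (a : SuperComposition m n r) (i : Fin (m + n)) : Set (Fin r) :=
  {x | ∑ j ∈ Finset.univ.filter (fun j => j < i), a.1 j ≤ (x : ℕ) ∧
    (x : ℕ) < ∑ j ∈ Finset.univ.filter (fun j => j ≤ i), a.1 j}

open Classical in
/-- The even part of the parabolic subgroup `W_λ`: the permutations that leave every block invariant
and fix all letters in the odd blocks. -/
def evenParabolic {m n r : ℕ} (a : SuperComposition m n r) : Finset (Equiv.Perm (Fin r)) :=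
  Finset.univ.filter fun w => (∀ i, ∀ x ∈ block a i, w x ∈ block a i) ∧
    ∀ i : Fin (m + n), m ≤ (i : ℕ) → ∀ x ∈ block a i, w x = x

open Classical in
/-- The odd part of the parabolic subgroup `W_λ`: the permutations that leave every block invariant
and fix all letters in the even blocks. -/
def oddParabolic {m n r : ℕ} (a : SuperComposition m n r) : Finset (Equiv.Perm (Fin r)) :=
  Finset.univ.filter fun w => (∀ i, ∀ x ∈ block a i, w x ∈ block a i) ∧
    ∀ i : Fin (m + n), (i : ℕ) < m → ∀ x ∈ block a i, w x = x

/-! ### The `q`-Schur superalgebra -/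

section Schur

variable {m n r : ℕ} (R : Type*) [CommRing R] (q : Rˣ)

/-- `x_{λ⁽⁰⁾} = ∑ T_w`, the sum over the even part of `W_λ`. -/
def xElt (a : SuperComposition m n r) : HeckeAlgebra R q r :=
  ∑ w ∈ evenParabolic a, HeckeAlgebra.T q w

/-- `y_{λ⁽¹⁾} = ∑ (-q)^{-ℓ(w)} T_w`, the sum over the odd part of `W_λ`. -/
def yElt (a : SuperComposition m n r) : HeckeAlgebra R q r :=
  ∑ w ∈ oddParabolic a, ((((-q)⁻¹ ^ length w : Rˣ) : R)) • HeckeAlgebra.T q w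

/-- The right ideal of the Hecke algebra generated by `x_{λ⁽⁰⁾} y_{λ⁽¹⁾}`. Right modules are modules
over the opposite algebra. -/
def permModule (a : SuperComposition m n r) :
    Submodule (HeckeAlgebra R q r)ᵐᵒᵖ (HeckeAlgebra R q r) :=
  Submodule.span _ {xElt R q a * yElt R q a}

variable (m n r) in
/-- The tensor space: the direct sum, over all `λ ∈ Λ(m|n, r)`, of the right ideals generated by
`x_{λ⁽⁰⁾} y_{λ⁽¹⁾}`. As `Λ(m|n, r)` is finite, the direct sum is the module of all families. -/
abbrev TensorSpace : Type _ := ∀ a : SuperComposition m n r, permModule R q a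

variable (m n r) in
/-- The endomorphism algebra of the tensor space as a right module over the Hecke algebra. If `1 + q`
is not a zero divisor in `R`, this is the `q`-Schur superalgebra over `R`. -/
def SchurEnd : Type _ := Module.End (HeckeAlgebra R q r)ᵐᵒᵖ (TensorSpace m n r R q)

instance : Ring (SchurEnd m n r R q) :=
  inferInstanceAs (Ring (Module.End (HeckeAlgebra R q r)ᵐᵒᵖ (TensorSpace m n r R q)))

instance : Algebra R (SchurEnd m n r R q) :=
  inferInstanceAs (Algebra R (Module.End (HeckeAlgebra R q r)ᵐᵒᵖ (TensorSpace m n r R q)))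

end Schur

/-- The ring `ℤ[υ, υ⁻¹]`. -/
abbrev GenericRing : Type := LaurentPolynomial ℤ

/-- The indeterminate `υ` as a unit of `ℤ[υ, υ⁻¹]`. -/
def genericParam : GenericRingˣ where
  val := LaurentPolynomial.T 1
  inv := LaurentPolynomial.T (-1)
  val_inv := by rw [← LaurentPolynomial.T_add, add_neg_cancel, LaurentPolynomial.T_zero]
  inv_val := by rw [← LaurentPolynomial.T_add, neg_add_cancel, LaurentPolynomial.T_zero]

/-- The specialisation `ℤ[υ, υ⁻¹] → R` that sends the indeterminate to a given unit. -/
def specialize {R : Type*} [CommRing R] (v : Rˣ) : GenericRing →+* R :=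
  LaurentPolynomial.eval₂ (Int.castRingHom R) v

theorem specialize_genericParam {R : Type*} [CommRing R] (v : Rˣ) :
    specialize v (genericParam : GenericRing) = v := by
  simp [specialize, genericParam]

/-- The ring `R`, regarded as an algebra over `ℤ[υ, υ⁻¹]` through the specialisation at `v`. -/
def SpecializedRing {R : Type*} [CommRing R] (_v : Rˣ) : Type _ := R

instance {R : Type*} [CommRing R] (v : Rˣ) : CommRing (SpecializedRing v) :=
  inferInstanceAs (CommRing R)

instance {R : Type*} [CommRing R] (v : Rˣ) : Algebra GenericRing (SpecializedRing v) :=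
  RingHom.toAlgebra (S := SpecializedRing v) (specialize v)

/-- The `q`-Schur superalgebra over `R` at `q = v²`, obtained by base change along the
specialisation `ℤ[υ, υ⁻¹] → R`, `υ ↦ v`, from the generic `q`-Schur superalgebra, which is the
endomorphism algebra of the tensor space over `ℤ[υ, υ⁻¹]` at `q = υ²`. -/
def SchurSuper (m n r : ℕ) {R : Type*} [CommRing R] (v : Rˣ) : Type _ :=
  SpecializedRing v ⊗[GenericRing] SchurEnd m n r GenericRing (genericParam ^ 2)

instance (m n r : ℕ) {R : Type*} [CommRing R] (v : Rˣ) : Ring (SchurSuper m n r v) :=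
  inferInstanceAs
    (Ring (SpecializedRing v ⊗[GenericRing] SchurEnd m n r GenericRing (genericParam ^ 2)))

instance (m n r : ℕ) {R : Type*} [CommRing R] (v : Rˣ) : Algebra R (SchurSuper m n r v) :=
  inferInstanceAs (Algebra (SpecializedRing v)
    (SpecializedRing v ⊗[GenericRing] SchurEnd m n r GenericRing (genericParam ^ 2)))

/-- The `F`-algebra `A` has, up to isomorphism, exactly `k` simple left modules, and they all have
dimension `d` over `F`. -/
def HasExactlySimples.{u, v, w} (F : Type u) [Field F] (A : Type v) [Ring A] [Algebra F A]
    (k d : ℕ) : Prop :=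
  ∃ (L : Fin k → Type v) (_ : ∀ i, AddCommGroup (L i)) (_ : ∀ i, Module A (L i)),
    (∀ i, IsSimpleModule A (L i)) ∧
    (∀ i, Module.finrank F (RestrictScalars F A (L i)) = d) ∧
    (∀ i j, i ≠ j → IsEmpty (L i ≃ₗ[A] L j)) ∧
    ∀ (M : Type w) [AddCommGroup M] [Module A M], IsSimpleModule A M →
      ∃ i, Nonempty (M ≃ₗ[A] L i)

end QSchur

end

universe u w

noncomputable section

namespace QSchur

/-! ### The fermionic Fock space -/

section Ring

variable {S : Type*} [Ring S]

/-! The tensor space is a Fock space on which the Hecke algebra acts through fermions. A subset `A`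
of the `r` letters corresponds to the sum of the `T_w` over all `w` carrying `A` onto the first
`|A|` letters, each weighted by a power of `(-q)⁻¹`. These sums form a basis of the right ideal
generated by `x_a y_a`, `a = |A|`, whose generator is the vector `vac a` of the initial set
(`xElt_mul_yElt`, `mem_permModule_iff`). Right multiplication by `T_s` becomes `fockT`, a product of
two fermionic linear forms minus `1`. So the endomorphism algebra is the commutant of the operators
`fockT` (`schurEndEquiv`).

The commutant contains the weight projections `e a` and the odd operators `E = raising` and `F =
lowering`. The canonical anticommutation relations give `E² = F² = 0` and `E F + F E = c` with `c =
1 + q⁻¹ + … + q^{-(r-1)}`. An element of the commutant is determined by its values at the vectors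
`vac a` (`eq_of_vac`), and each value is a simultaneous eigenvector of some of the `T_s`. If `1 + q`
is not a zero divisor, all such eigenvectors are combinations of `vac a`, `E vac a`, `F vac a`, `E F
vac a` (`exists_eq_of_eigen`). Hence the commutant is spanned by the `e a`, `E e a`, `F e a`, `E F e
a`; this is recorded in `IsRankOneSchur`, which is stable under base change. Over `ℤ[υ, υ⁻¹]` the
element `1 + υ²` is regular, so the specialised algebra is covered for every `q`. Over the field
itself, `q ≠ -1` is needed.

The rest is representation theory over a field, and only `c` matters. As `q ≠ 1`, the geometric sum
`c` vanishes exactly when `l ∣ r`. If `c ≠ 0`, a vector `m` of weight `a` killed by `E` generates a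
simple module with basis `m`, `F m`. The possible weights are `1, …, r`, and such modules fill the
regular module. If `c = 0`, then `E` and `F` anticommute and square to zero, so `F` acts as zero on
every simple module and the simple modules are the `r + 1` weight lines. Semisimplicity would then
force `F = 0`. -/

theorem comm_mul_sub_one_of_anticomm {z x y : S} (hx : z * x = -(x * z)) (hy : z * y = -(y * z)) :
    z * (x * y - 1) = (x * y - 1) * z := by
  rw [mul_sub_one, sub_one_mul, ← mul_assoc, hx, neg_mul, mul_assoc, hy, mul_neg, neg_neg,
    mul_assoc]

/-- The off-diagonal terms cancel in pairs. The vanishing of the squares is a separate hypothesis,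
because anticommutation alone gives only twice a square and `2` may be a zero divisor. -/
theorem sum_mul_sum_self_of_anticomm {ι : Type*} (s : Finset ι) (x : ι → S)
    (h : ∀ i j, x i * x j + x j * x i = 0) (h' : ∀ i, x i * x i = 0) :
    (∑ i ∈ s, x i) * ∑ i ∈ s, x i = 0 := by
  classical
  induction s using Finset.induction_on with
  | empty => simp
  | insert a s ha ih =>
    have h2 : x a * ∑ i ∈ s, x i + (∑ i ∈ s, x i) * x a = 0 := by
      rw [Finset.mul_sum, Finset.sum_mul, ← Finset.sum_add_distrib]
      exact Finset.sum_eq_zero fun i _ => h a i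
    rw [Finset.sum_insert ha, add_mul, mul_add, mul_add, h', ih, zero_add, add_zero, h2]

end Ring

section Fock

variable {r : ℕ}

/-- Add the letter `i` to `A`, or remove it. -/
def toggle (i : Fin r) (A : Finset (Fin r)) : Finset (Fin r) := symmDiff A {i}

theorem mem_toggle {i j : Fin r} {A : Finset (Fin r)} :
    j ∈ toggle i A ↔ (j ∈ A ∧ j ≠ i ∨ j = i ∧ j ∉ A) := by
  simp [toggle, Finset.mem_symmDiff]

theorem mem_toggle_self {i : Fin r} {A : Finset (Fin r)} : i ∈ toggle i A ↔ i ∉ A := by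
  simp [mem_toggle]

theorem mem_toggle_of_ne {i j : Fin r} {A : Finset (Fin r)} (h : j ≠ i) :
    j ∈ toggle i A ↔ j ∈ A := by
  simp [mem_toggle, h]

theorem toggle_toggle (i : Fin r) (A : Finset (Fin r)) : toggle i (toggle i A) = A := by
  ext j; simp only [mem_toggle]; tauto

theorem toggle_comm (i j : Fin r) (A : Finset (Fin r)) :
    toggle i (toggle j A) = toggle j (toggle i A) := by
  simp only [toggle, symmDiff_assoc, symmDiff_comm {i}]

theorem toggle_eq_insert {i : Fin r} {A : Finset (Fin r)} (h : i ∉ A) :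
    toggle i A = insert i A := by
  ext j; simp only [mem_toggle, Finset.mem_insert]
  by_cases hj : j = i
  · subst hj; tauto
  · tauto

theorem toggle_eq_erase {i : Fin r} {A : Finset (Fin r)} (h : i ∈ A) :
    toggle i A = A.erase i := by
  ext j; simp only [mem_toggle, Finset.mem_erase]
  by_cases hj : j = i
  · subst hj; tauto
  · tauto

theorem card_toggle_of_notMem {i : Fin r} {A : Finset (Fin r)} (h : i ∉ A) :
    (toggle i A).card = A.card + 1 := by
  rw [toggle_eq_insert h, Finset.card_insert_of_notMem h]

theorem card_toggle_of_mem {i : Fin r} {A : Finset (Fin r)} (h : i ∈ A) :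
    (toggle i A).card + 1 = A.card := by
  rw [toggle_eq_erase h, Finset.card_erase_add_one h]

variable (R : Type*) [CommRing R]

/-- The sign `(-1)^n`, where `n` is the number of letters before `i` that are missing in `A`. -/
def fockSign (i : Fin r) (A : Finset (Fin r)) : R :=
  ∏ j : Fin r, if j < i ∧ j ∉ A then -1 else 1

theorem fockSign_mul_self (i : Fin r) (A : Finset (Fin r)) :
    fockSign R i A * fockSign R i A = 1 := by
  rw [fockSign, ← Finset.prod_mul_distrib]
  exact Finset.prod_eq_one fun j _ => by split_ifs <;> simp

/-- Changing the status of `i` changes the count of missing letters before `j` by one exactly when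
`i < j`. This is the source of all anticommutation relations below. -/
theorem fockSign_toggle (i j : Fin r) (A : Finset (Fin r)) :
    fockSign R j (toggle i A) = if i < j then -fockSign R j A else fockSign R j A := by
  split_ifs with h
  · rw [fockSign, fockSign, ← Finset.mul_prod_erase _ _ (Finset.mem_univ i),
      ← Finset.mul_prod_erase Finset.univ (fun x => if x < j ∧ x ∉ A then (-1 : R) else 1)
        (Finset.mem_univ i)]
    have h1 : ∏ x ∈ Finset.univ.erase i, (if x < j ∧ x ∉ toggle i A then (-1 : R) else 1) =
        ∏ x ∈ Finset.univ.erase i, (if x < j ∧ x ∉ A then (-1 : R) else 1) :=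
      Finset.prod_congr rfl fun x hx => by
        simp only [mem_toggle_of_ne (Finset.ne_of_mem_erase hx)]
    rw [h1]
    by_cases hi : i ∈ A <;> simp [mem_toggle_self, h, hi]
  · refine Finset.prod_congr rfl fun x _ => ?_
    by_cases hx : x = i
    · subst hx; simp [h]
    · simp only [mem_toggle_of_ne hx]

/-- The Fock space: the free module on the subsets of the set of `r` letters. -/
abbrev Fock (r : ℕ) : Type _ := Finset (Fin r) → R

/-- The operator that adds the letter `i`. -/
def creation (i : Fin r) : Module.End R (Fock R r) where
  toFun g A := if i ∈ A then fockSign R i A * g (toggle i A) else 0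
  map_add' g h := by
    ext A; simp only [Pi.add_apply]; split_ifs <;> ring
  map_smul' c g := by
    ext A; simp only [Pi.smul_apply, smul_eq_mul, RingHom.id_apply]; split_ifs <;> ring

/-- The operator that removes the letter `i`. -/
def annihilation (i : Fin r) : Module.End R (Fock R r) where
  toFun g A := if i ∈ A then 0 else fockSign R i A * g (toggle i A)
  map_add' g h := by
    ext A; simp only [Pi.add_apply]; split_ifs <;> ring
  map_smul' c g := by
    ext A; simp only [Pi.smul_apply, smul_eq_mul, RingHom.id_apply]; split_ifs <;> ring

variable {R}

theorem creation_apply (i : Fin r) (g : Fock R r) (A : Finset (Fin r)) :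
    creation R i g A = if i ∈ A then fockSign R i A * g (toggle i A) else 0 := rfl

theorem annihilation_apply (i : Fin r) (g : Fock R r) (A : Finset (Fin r)) :
    annihilation R i g A = if i ∈ A then 0 else fockSign R i A * g (toggle i A) := rfl

theorem creation_anticomm (i j : Fin r) :
    creation R i * creation R j + creation R j * creation R i = 0 := by
  refine LinearMap.ext fun g => funext fun A => ?_
  simp only [LinearMap.add_apply, Module.End.mul_apply, Pi.add_apply, creation_apply,
    LinearMap.zero_apply, Pi.zero_apply, fockSign_toggle, toggle_comm i j]
  rcases lt_trichotomy i j with h | rfl | h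
  · simp only [mem_toggle_of_ne h.ne, mem_toggle_of_ne h.ne', h, h.not_gt, if_true, if_false]
    split_ifs <;> ring
  · simp only [mem_toggle_self]
    split_ifs <;> ring
  · simp only [mem_toggle_of_ne h.ne, mem_toggle_of_ne h.ne', h, h.not_gt, if_true, if_false]
    split_ifs <;> ring

theorem annihilation_anticomm (i j : Fin r) :
    annihilation R i * annihilation R j + annihilation R j * annihilation R i = 0 := by
  refine LinearMap.ext fun g => funext fun A => ?_
  simp only [LinearMap.add_apply, Module.End.mul_apply, Pi.add_apply, annihilation_apply,
    LinearMap.zero_apply, Pi.zero_apply, fockSign_toggle, toggle_comm i j]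
  rcases lt_trichotomy i j with h | rfl | h
  · simp only [mem_toggle_of_ne h.ne, mem_toggle_of_ne h.ne', h, h.not_gt, if_true, if_false]
    split_ifs <;> ring
  · simp only [mem_toggle_self]
    split_ifs <;> ring
  · simp only [mem_toggle_of_ne h.ne, mem_toggle_of_ne h.ne', h, h.not_gt, if_true, if_false]
    split_ifs <;> ring

theorem creation_annihilation_anticomm (i j : Fin r) :
    creation R i * annihilation R j + annihilation R j * creation R i =
      if i = j then 1 else 0 := by
  refine LinearMap.ext fun g => funext fun A => ?_
  simp only [LinearMap.add_apply, Module.End.mul_apply, Pi.add_apply, creation_apply,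
    annihilation_apply, fockSign_toggle, toggle_comm i j]
  rcases lt_trichotomy i j with h | rfl | h
  · simp only [mem_toggle_of_ne h.ne, mem_toggle_of_ne h.ne', h, h.not_gt, h.ne, if_true, if_false,
      LinearMap.zero_apply, Pi.zero_apply]
    split_ifs <;> ring
  · simp only [mem_toggle_self, lt_irrefl, if_true, if_false, Module.End.one_apply,
      toggle_toggle]
    split_ifs <;> simp [← mul_assoc, fockSign_mul_self]
  · simp only [mem_toggle_of_ne h.ne, mem_toggle_of_ne h.ne', h, h.not_gt, h.ne', if_true, if_false,
      LinearMap.zero_apply, Pi.zero_apply]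
    split_ifs <;> ring

variable (q : Rˣ)

/-- The operator by which `T_s`, `s` the basic transposition of `k` and `k + 1`, acts on the Fock
space. -/
def fockT (k : Fin (r - 1)) : Module.End R (Fock R r) :=
  (creation R (lo k) - creation R (hi k)) *
    (annihilation R (lo k) - (q : R) • annihilation R (hi k)) - 1

variable (r) in
/-- The odd operator that raises the number of letters by one. -/
def raising : Module.End R (Fock R r) :=
  ∑ i : Fin r, ((q⁻¹ ^ (i : ℕ) : Rˣ) : R) • creation R i

variable (R r) in
/-- The odd operator that lowers the number of letters by one. -/
def lowering : Module.End R (Fock R r) := ∑ i : Fin r, annihilation R i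

variable (R r) in
/-- The projection onto the part of the Fock space with `a` letters. -/
def weightProj (a : ℕ) : Module.End R (Fock R r) where
  toFun g A := if A.card = a then g A else 0
  map_add' g h := by
    ext A; simp only [Pi.add_apply]; split_ifs <;> simp
  map_smul' c g := by
    ext A; simp only [Pi.smul_apply, smul_eq_mul, RingHom.id_apply]; split_ifs <;> simp

theorem weightProj_apply (a : ℕ) (g : Fock R r) (A : Finset (Fin r)) :
    weightProj r R a g A = if A.card = a then g A else 0 := rfl

theorem raising_mul_creation (j : Fin r) :
    raising r q * creation R j = -(creation R j * raising r q) := by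
  rw [eq_neg_iff_add_eq_zero, raising, Finset.sum_mul, Finset.mul_sum, ← Finset.sum_add_distrib]
  refine Finset.sum_eq_zero fun i _ => ?_
  rw [smul_mul_assoc, mul_smul_comm, ← smul_add, creation_anticomm, smul_zero]

theorem lowering_mul_annihilation (j : Fin r) :
    lowering r R * annihilation R j = -(annihilation R j * lowering r R) := by
  rw [eq_neg_iff_add_eq_zero, lowering, Finset.sum_mul, Finset.mul_sum, ← Finset.sum_add_distrib]
  exact Finset.sum_eq_zero fun i _ => annihilation_anticomm i j

theorem raising_mul_annihilation (j : Fin r) :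
    raising r q * annihilation R j =
      ((q⁻¹ ^ (j : ℕ) : Rˣ) : R) • 1 - annihilation R j * raising r q := by
  rw [eq_sub_iff_add_eq, raising, Finset.sum_mul, Finset.mul_sum, ← Finset.sum_add_distrib]
  rw [Finset.sum_eq_single j]
  · rw [smul_mul_assoc, mul_smul_comm, ← smul_add, creation_annihilation_anticomm, if_pos rfl]
  · intro i _ hi
    rw [smul_mul_assoc, mul_smul_comm, ← smul_add, creation_annihilation_anticomm, if_neg hi,
      smul_zero]
  · simp

theorem lowering_mul_creation (j : Fin r) :
    lowering r R * creation R j = 1 - creation R j * lowering r R := by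
  rw [eq_sub_iff_add_eq, lowering, Finset.sum_mul, Finset.mul_sum, ← Finset.sum_add_distrib]
  rw [Finset.sum_eq_single j]
  · rw [add_comm, creation_annihilation_anticomm, if_pos rfl]
  · intro i _ hi
    rw [add_comm, creation_annihilation_anticomm, if_neg hi.symm]
  · simp

/-- Both factors of `fockT` anticommute with `raising`. For the annihilation factor this needs the
scalars `q^{-k}` and `q · q^{-(k+1)}` to cancel, which explains the coefficients `q^{-i}` in
`raising`. -/
theorem raising_comm_fockT (k : Fin (r - 1)) :
    raising r q * fockT q k = fockT q k * raising r q := by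
  have h : ((q⁻¹ ^ ((lo k : Fin r) : ℕ) : Rˣ) : R) =
      (q : R) * ((q⁻¹ ^ ((hi k : Fin r) : ℕ) : Rˣ) : R) := by
    rw [← Units.val_mul]; congr 1; simp [lo, hi, pow_succ']
  have hx : raising r q * (creation R (lo k) - creation R (hi k)) =
      -((creation R (lo k) - creation R (hi k)) * raising r q) := by
    rw [mul_sub, sub_mul, raising_mul_creation, raising_mul_creation]; abel
  have hy : raising r q * (annihilation R (lo k) - (q : R) • annihilation R (hi k)) =
      -((annihilation R (lo k) - (q : R) • annihilation R (hi k)) * raising r q) := by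
    rw [mul_sub, sub_mul, mul_smul_comm, smul_mul_assoc, raising_mul_annihilation,
      raising_mul_annihilation, h]
    module
  exact comm_mul_sub_one_of_anticomm hx hy

/-- Here the scalars come from the creation factor: each creation operator contributes `1`, and the
difference of two of them contributes nothing. -/
theorem lowering_comm_fockT (k : Fin (r - 1)) :
    lowering r R * fockT q k = fockT q k * lowering r R := by
  have hx : lowering r R * (creation R (lo k) - creation R (hi k)) =
      -((creation R (lo k) - creation R (hi k)) * lowering r R) := by
    rw [mul_sub, sub_mul, lowering_mul_creation, lowering_mul_creation]; abel
  have hy : lowering r R * (annihilation R (lo k) - (q : R) • annihilation R (hi k)) =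
      -((annihilation R (lo k) - (q : R) • annihilation R (hi k)) * lowering r R) := by
    rw [mul_sub, sub_mul, mul_smul_comm, smul_mul_assoc, lowering_mul_annihilation,
      lowering_mul_annihilation]
    module
  exact comm_mul_sub_one_of_anticomm hx hy

theorem raising_lowering_add :
    raising r q * lowering r R + lowering r R * raising r q =
      algebraMap R _ (∑ i ∈ Finset.range r, ((q⁻¹ ^ i : Rˣ) : R)) := by
  have h : raising r q * lowering r R =
      (∑ i : Fin r, ((q⁻¹ ^ (i : ℕ) : Rˣ) : R)) • 1 - lowering r R * raising r q := by
    conv_lhs => rw [lowering, Finset.mul_sum]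
    simp_rw [raising_mul_annihilation]
    rw [Finset.sum_sub_distrib, ← Finset.sum_mul, ← Finset.sum_smul, lowering]
  rw [h, sub_add_cancel, Algebra.algebraMap_eq_smul_one,
    Fin.sum_univ_eq_sum_range (fun i => ((q⁻¹ ^ i : Rˣ) : R))]

theorem weightProj_succ_mul_creation (a : ℕ) (i : Fin r) :
    weightProj r R (a + 1) * creation R i = creation R i * weightProj r R a := by
  refine LinearMap.ext fun g => funext fun A => ?_
  simp only [Module.End.mul_apply, weightProj_apply, creation_apply]
  by_cases h : i ∈ A
  · have := card_toggle_of_mem h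
    by_cases h' : A.card = a + 1
    · simp [h, h', show (toggle i A).card = a by omega]
    · simp [h, h', show ¬ (toggle i A).card = a by omega]
  · simp [h]

theorem weightProj_mul_annihilation (a : ℕ) (i : Fin r) :
    weightProj r R a * annihilation R i = annihilation R i * weightProj r R (a + 1) := by
  refine LinearMap.ext fun g => funext fun A => ?_
  simp only [Module.End.mul_apply, weightProj_apply, annihilation_apply]
  by_cases h : i ∈ A
  · simp [h]
  · have := card_toggle_of_notMem h
    by_cases h' : A.card = a
    · simp [h, h', show (toggle i A).card = a + 1 by omega]
    · simp [h, h', show ¬ (toggle i A).card = a + 1 by omega]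

theorem weightProj_succ_mul_raising (a : ℕ) :
    weightProj r R (a + 1) * raising r q = raising r q * weightProj r R a := by
  simp only [raising, Finset.mul_sum, Finset.sum_mul, mul_smul_comm, smul_mul_assoc,
    weightProj_succ_mul_creation]

theorem weightProj_mul_lowering (a : ℕ) :
    weightProj r R a * lowering r R = lowering r R * weightProj r R (a + 1) := by
  simp only [lowering, Finset.mul_sum, Finset.sum_mul, weightProj_mul_annihilation]

theorem weightProj_mul_weightProj (a b : ℕ) :
    weightProj r R a * weightProj r R b = if a = b then weightProj r R a else 0 := by
  refine LinearMap.ext fun g => funext fun A => ?_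
  simp only [Module.End.mul_apply, weightProj_apply]
  by_cases h : a = b
  · subst h; simp +contextual [weightProj_apply]
  · rw [if_neg h]
    by_cases h' : A.card = a
    · simp [h', h]
    · simp [h']

theorem sum_weightProj : ∑ a ∈ Finset.range (r + 1), weightProj r R a = 1 := by
  refine LinearMap.ext fun g => funext fun A => ?_
  have : A.card ≤ r := by simpa using Finset.card_le_univ A
  simp [LinearMap.sum_apply, Finset.sum_apply, weightProj_apply, Nat.lt_succ_of_le this]

theorem weightProj_comm_fockT (a : ℕ) (k : Fin (r - 1)) :
    weightProj r R a * fockT q k = fockT q k * weightProj r R a := by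
  have h (i j : Fin r) : weightProj r R a * (creation R i * annihilation R j) =
      creation R i * annihilation R j * weightProj r R a := by
    cases a with
    -- There is no weight `-1` through which to move the projection, so weight `0` is done by hand:
    -- both sides vanish, because a letter was just created on one side and must still be
    -- annihilated on the other.
    | zero =>
      refine LinearMap.ext fun g => funext fun A => ?_
      simp only [Module.End.mul_apply, weightProj_apply, creation_apply, annihilation_apply,
        Finset.card_eq_zero]
      by_cases hi : i ∈ A
      · have hA : A ≠ ∅ := Finset.ne_empty_of_mem hi
        simp only [hA, hi, if_false, if_true]
        by_cases hj : j ∈ toggle i A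
        · simp [hj]
        · have : toggle j (toggle i A) ≠ ∅ := by
            rw [toggle_eq_insert hj]; simp
          simp [this]
      · simp [hi]
    | succ a =>
      rw [← mul_assoc, weightProj_succ_mul_creation, mul_assoc, weightProj_mul_annihilation,
        mul_assoc]
  simp only [fockT, mul_sub, sub_mul, mul_one, one_mul, mul_smul_comm, smul_mul_assoc, h]

theorem creation_mul_self (i : Fin r) : creation R i * creation R i = 0 := by
  refine LinearMap.ext fun g => funext fun A => ?_
  simp only [Module.End.mul_apply, creation_apply, mem_toggle_self]
  by_cases h : i ∈ A <;> simp [h]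

theorem annihilation_mul_self (i : Fin r) : annihilation R i * annihilation R i = 0 := by
  refine LinearMap.ext fun g => funext fun A => ?_
  simp only [Module.End.mul_apply, annihilation_apply, mem_toggle_self]
  by_cases h : i ∈ A <;> simp [h]

theorem raising_mul_self : raising r q * raising r q = 0 := by
  refine sum_mul_sum_self_of_anticomm _ _ (fun i j => ?_) fun i => ?_
  · rw [smul_mul_smul_comm, smul_mul_smul_comm, mul_comm (Units.val _), ← smul_add,
      creation_anticomm, smul_zero]
  · rw [smul_mul_smul_comm, creation_mul_self, smul_zero]

theorem lowering_mul_self : lowering r R * lowering r R = 0 :=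
  sum_mul_sum_self_of_anticomm _ _ annihilation_anticomm annihilation_mul_self

theorem lowering_mul_weightProj_zero : lowering r R * weightProj r R 0 = 0 := by
  refine LinearMap.ext fun g => funext fun A => ?_
  simp only [lowering, Module.End.mul_apply, LinearMap.sum_apply, Finset.sum_apply,
    annihilation_apply, weightProj_apply, LinearMap.zero_apply, Pi.zero_apply]
  refine Finset.sum_eq_zero fun i _ => ?_
  split_ifs with h h'
  · rfl
  · have := card_toggle_of_notMem h; omega
  · simp

/-- Exchange of the letters `k` and `k + 1` in a set that contains exactly one of them. -/
def exchange (k : Fin (r - 1)) (A : Finset (Fin r)) : Finset (Fin r) :=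
  toggle (lo k) (toggle (hi k) A)

/-- The action is local at the two letters: the eigenvalue is `q` if both belong to `A` and `-1` if
neither does, and the two mixed sets are exchanged as in a two-dimensional Hecke module. No sign
survives, since the signs of `lo k` and `hi k` differ only through the membership of `lo k`. -/
theorem fockT_apply (k : Fin (r - 1)) (g : Fock R r) (A : Finset (Fin r)) :
    fockT q k g A =
      if lo k ∈ A then (if hi k ∈ A then (q : R) * g A else (q : R) * g (exchange k A))
      else if hi k ∈ A then g (exchange k A) + ((q : R) - 1) * g A else - g A := by
  have h := lo_lt_hi k
  have hs : ∀ x : Fin r, x ≠ lo k → (x < hi k ↔ x < lo k) := by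
    intro x hx
    have := Fin.val_ne_of_ne hx
    simp only [lo, hi, Fin.lt_def] at this ⊢; omega
  have hsign : fockSign R (hi k) A =
      if lo k ∈ A then fockSign R (lo k) A else -fockSign R (lo k) A := by
    rw [fockSign, fockSign, ← Finset.mul_prod_erase _ _ (Finset.mem_univ (lo k)),
      ← Finset.mul_prod_erase Finset.univ (fun x => if x < lo k ∧ x ∉ A then (-1 : R) else 1)
        (Finset.mem_univ (lo k)), Finset.prod_congr rfl fun x hx => by
          simp only [hs x (Finset.ne_of_mem_erase hx)]; rfl]
    by_cases hl : lo k ∈ A <;> simp [h, hl]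
  have e := fockSign_mul_self R (lo k) A
  simp only [fockT, exchange, LinearMap.sub_apply, Module.End.mul_apply, Pi.sub_apply,
    creation_apply, annihilation_apply, LinearMap.smul_apply, Pi.smul_apply, smul_eq_mul,
    Module.End.one_apply, fockSign_toggle, mem_toggle_self, mem_toggle_of_ne h.ne,
    mem_toggle_of_ne h.ne', h, h.not_gt, toggle_toggle, toggle_comm (hi k) (lo k), lt_irrefl,
    if_true, if_false, hsign]
  by_cases hl : lo k ∈ A <;> by_cases hh : hi k ∈ A <;>
    simp only [hl, hh, not_true, not_false_eq_true, if_true, if_false]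
  · linear_combination (g A + q * g A) * e
  · linear_combination (g A + q * g (toggle (lo k) (toggle (hi k) A))) * e
  · linear_combination (g (toggle (lo k) (toggle (hi k) A)) + q * g A) * e
  · ring

end Fock

/-! ### ### Eigenvectors in the Fock space and generation by the vacuum vectors -/

section Commutant

variable {r : ℕ}

/-- The set of the first `a` letters. -/
def initialSet (r a : ℕ) : Finset (Fin r) := Finset.univ.filter fun x => (x : ℕ) < a

theorem mem_initialSet {a : ℕ} {x : Fin r} : x ∈ initialSet r a ↔ (x : ℕ) < a := by
  simp [initialSet]

theorem card_initialSet {a : ℕ} (h : a ≤ r) : (initialSet r a).card = a := by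
  rw [initialSet, Fin.card_filter_val_lt, min_eq_right h]

theorem exchange_eq {k : Fin (r - 1)} {A : Finset (Fin r)} (hl : lo k ∉ A) (hh : hi k ∈ A) :
    exchange k A = insert (lo k) (A.erase (hi k)) := by
  rw [exchange, toggle_eq_erase hh, toggle_eq_insert]
  simp [hl]

theorem sum_exchange {k : Fin (r - 1)} {A : Finset (Fin r)} (hl : lo k ∉ A) (hh : hi k ∈ A) :
    (∑ x ∈ exchange k A, (x : ℕ)) + 1 = ∑ x ∈ A, (x : ℕ) := by
  rw [exchange_eq hl hh, Finset.sum_insert (by simp [hl]), ← Finset.add_sum_erase _ _ hh]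
  simp only [lo, hi]; omega

theorem card_exchange {k : Fin (r - 1)} {A : Finset (Fin r)} (hl : lo k ∉ A) (hh : hi k ∈ A) :
    (exchange k A).card = A.card := by
  rw [exchange_eq hl hh, Finset.card_insert_of_notMem (by simp [hl]), Finset.card_erase_add_one hh]

theorem lo_mem_exchange {k : Fin (r - 1)} {A : Finset (Fin r)} :
    lo k ∈ exchange k A ↔ lo k ∉ A := by
  rw [exchange, mem_toggle_self, mem_toggle_of_ne (lo_lt_hi k).ne]

theorem hi_mem_exchange {k : Fin (r - 1)} {A : Finset (Fin r)} :
    hi k ∈ exchange k A ↔ hi k ∉ A := by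
  rw [exchange, mem_toggle_of_ne (lo_lt_hi k).ne', mem_toggle_self]

theorem exchange_exchange (k : Fin (r - 1)) (A : Finset (Fin r)) :
    exchange k (exchange k A) = A := by
  rw [exchange, exchange, toggle_comm (hi k), toggle_toggle, toggle_toggle]

theorem initial_of_lower {A : Finset (Fin r)}
    (h : ∀ k : Fin (r - 1), hi k ∈ A → lo k ∈ A) : A = initialSet r A.card := by
  have hstep : ∀ n : ℕ, ∀ x : Fin r, ∀ y : Fin r, (y : ℕ) + n = x → x ∈ A → y ∈ A := by
    intro n
    induction n with
    | zero => intro x y hxy hx; rwa [show y = x from Fin.ext hxy]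
    | succ n ih =>
      intro x y hxy hx
      have hy : (y : ℕ) < r - 1 := by omega
      have := ih x (hi ⟨y, hy⟩) (by simp only [hi]; omega) hx
      exact h ⟨y, hy⟩ this
  have hcard : A.card ≤ r := by simpa using Finset.card_le_univ A
  refine Finset.eq_of_subset_of_card_le (fun x hx => ?_) (card_initialSet hcard).le
  rw [mem_initialSet]
  have h1 : initialSet r (x + 1) ⊆ A := fun y hy => by
    rw [mem_initialSet] at hy
    exact hstep (x - y) x y (by omega) hx
  have := Finset.card_le_card h1
  rw [card_initialSet x.2] at this
  omega

variable {R : Type*} [CommRing R] (q : Rˣ)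

variable (R r) in
/-- The basis vector of the Fock space at the set of the first `a` letters. -/
def vac (a : ℕ) : Fock R r := Pi.single (initialSet r a) 1

theorem fockT_single {k : Fin (r - 1)} {A : Finset (Fin r)} (hl : lo k ∉ A) (hh : hi k ∈ A) :
    fockT q k (Pi.single (exchange k A) (1 : R)) = Pi.single A 1 := by
  funext C
  have hne : ∀ B : Finset (Fin r), (lo k ∈ B ↔ hi k ∈ B) → B ≠ A ∧ B ≠ exchange k A := by
    intro B hB
    constructor
    · rintro rfl; tauto
    · rintro rfl; rw [lo_mem_exchange, hi_mem_exchange] at hB; tauto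
  rw [fockT_apply]
  by_cases h1 : lo k ∈ C <;> by_cases h2 : hi k ∈ C <;>
    simp only [h1, h2, if_true, if_false]
  · have := hne C (by tauto)
    simp [this]
  · have h3 : exchange k C ≠ exchange k A := fun h => by
      have := congrArg (exchange k) h
      rw [exchange_exchange, exchange_exchange] at this
      subst this; tauto
    have h4 : C ≠ A := by rintro rfl; tauto
    simp [h3, h4]
  · have h3 : C ≠ exchange k A := by
      rintro rfl; rw [lo_mem_exchange] at h1; tauto
    by_cases h4 : C = A
    · subst h4; simp [h3]
    · have h5 : exchange k C ≠ exchange k A := fun h => by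
        have := congrArg (exchange k) h
        rw [exchange_exchange, exchange_exchange] at this
        exact h4 this
      simp [h3, h4, h5]
  · have := hne C (by tauto)
    simp [this]

/-- The part with `a` letters is cyclic over the Hecke action, generated by `vac a`. The induction
is on the sum of the letters: a set that is not initial contains some `k + 1` without `k`, and it is
obtained by `T_k` from the exchanged set, whose sum is smaller by one. -/
theorem single_mem_of_vac_mem (P : Submodule R (Fock R r))
    (hP : ∀ k, ∀ g ∈ P, fockT q k g ∈ P) (a : ℕ) (ha : vac r R a ∈ P) :
    ∀ n : ℕ, ∀ A : Finset (Fin r), (∑ x ∈ A, (x : ℕ)) = n → A.card = a → Pi.single A 1 ∈ P := by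
  intro n
  induction n with
  | zero =>
    intro A hA hc
    have : A = initialSet r A.card := initial_of_lower fun k hk => by
      by_contra hl
      have := sum_exchange hl hk
      omega
    rw [this, hc]; exact ha
  | succ n ih =>
    intro A hA hc
    by_cases h : ∀ k : Fin (r - 1), hi k ∈ A → lo k ∈ A
    · rw [initial_of_lower h, hc]; exact ha
    · push Not at h
      obtain ⟨k, hh, hl⟩ := h
      rw [← fockT_single q hl hh]
      have := sum_exchange hl hh
      exact hP k _ (ih _ (by omega) (by rw [card_exchange hl hh, hc]))

theorem mem_of_vac_mem (P : Submodule R (Fock R r))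
    (hP : ∀ k, ∀ g ∈ P, fockT q k g ∈ P) (a : ℕ) (ha : vac r R a ∈ P) (g : Fock R r)
    (hg : ∀ A, A.card ≠ a → g A = 0) : g ∈ P := by
  rw [pi_eq_sum_univ' g]
  refine Submodule.sum_mem _ fun A _ => ?_
  by_cases h : A.card = a
  · have := P.smul_mem (g A) (single_mem_of_vac_mem q P hP a ha _ A rfl h)
    convert this using 2
  · rw [hg A h, zero_smul]; exact P.zero_mem

theorem eq_of_vac {φ ψ : Module.End R (Fock R r)}
    (hφ : ∀ k, φ * fockT q k = fockT q k * φ) (hψ : ∀ k, ψ * fockT q k = fockT q k * ψ)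
    (h : ∀ a ≤ r, φ (vac r R a) = ψ (vac r R a)) : φ = ψ := by
  have key : ∀ A : Finset (Fin r), Pi.single A 1 ∈ LinearMap.ker (φ - ψ) := by
    intro A
    refine single_mem_of_vac_mem q _ (fun k g hg => ?_) A.card ?_ _ A rfl rfl
    · rw [LinearMap.mem_ker, LinearMap.sub_apply, sub_eq_zero] at hg ⊢
      rw [← Module.End.mul_apply, ← Module.End.mul_apply, hφ, hψ, Module.End.mul_apply,
        Module.End.mul_apply, hg]
    · rw [LinearMap.mem_ker, LinearMap.sub_apply, sub_eq_zero]
      exact h _ (by simpa using Finset.card_le_univ A)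
  apply (Pi.basisFun R (Finset (Fin r))).ext
  intro A
  have := key A
  rw [LinearMap.mem_ker, LinearMap.sub_apply, sub_eq_zero] at this
  simpa using this

theorem fockT_vac_of_lt {k : Fin (r - 1)} {a : ℕ} (h : (k : ℕ) + 1 < a) :
    fockT q k (vac r R a) = (q : R) • vac r R a := by
  funext A
  rw [fockT_apply, vac]
  have h1 : lo k ∈ initialSet r a := by rw [mem_initialSet]; simp only [lo]; omega
  have h2 : hi k ∈ initialSet r a := by rw [mem_initialSet]; simp only [hi]; omega
  have hne : ∀ B : Finset (Fin r), (lo k ∉ B ∨ hi k ∉ B) → B ≠ initialSet r a := by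
    rintro B hB rfl; tauto
  split_ifs with h3 h4 h4
  · simp
  · have := hne A (by tauto)
    have := hne (exchange k A) (by rw [lo_mem_exchange]; tauto)
    simp [*]
  · have := hne A (by tauto)
    have := hne (exchange k A) (by rw [hi_mem_exchange]; tauto)
    simp [*]
  · have := hne A (by tauto)
    simp [*]

theorem fockT_vac_of_le {k : Fin (r - 1)} {a : ℕ} (h : a ≤ k) :
    fockT q k (vac r R a) = -vac r R a := by
  funext A
  rw [fockT_apply, vac]
  have h1 : lo k ∉ initialSet r a := by rw [mem_initialSet]; simp only [lo]; omega
  have h2 : hi k ∉ initialSet r a := by rw [mem_initialSet]; simp only [hi]; omega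
  have hne : ∀ B : Finset (Fin r), (lo k ∈ B ∨ hi k ∈ B) → B ≠ initialSet r a := by
    rintro B hB rfl; tauto
  split_ifs with h3 h4 h4
  · have := hne A (by tauto)
    simp [*]
  · have := hne A (by tauto)
    have := hne (exchange k A) (by rw [hi_mem_exchange]; tauto)
    simp [*]
  · have := hne A (by tauto)
    have := hne (exchange k A) (by rw [lo_mem_exchange]; tauto)
    simp [*]
  · simp

/-- An eigenvector of the operators `T_s` with the eigenvalues of `vac a` vanishes if it vanishes at
the sets that differ from the first `a` letters at most at the letters `a - 1` and `a`. -/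
theorem eq_zero_of_eigen (hq : 1 + (q : R) ∈ nonZeroDivisors R) {a : ℕ} (ha : a ≤ r)
    {m : Fock R r}
    (h1 : ∀ k : Fin (r - 1), (k : ℕ) + 1 < a → fockT q k m = (q : R) • m)
    (h2 : ∀ k : Fin (r - 1), a ≤ k → fockT q k m = -m)
    (h3 : ∀ A, (∀ x : Fin r, (x : ℕ) + 1 < a → x ∈ A) → (∀ x : Fin r, a < x → x ∉ A) → m A = 0) :
    m = 0 := by
  have hz : ∀ z : R, (1 + (q : R)) * z = 0 → z = 0 := fun z hz =>
    (mem_nonZeroDivisors_iff.1 hq).1 z hz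
  have key : ∀ n : ℕ, ∀ A : Finset (Fin r), (∑ x ∈ A, (x : ℕ)) = n → m A = 0 := by
    intro n
    induction n using Nat.strong_induction_on with
    | _ n ih =>
      intro A hA
      -- If an allowed exchange lowers the sum of `A`, evaluating the eigenvector equation at the
      -- exchanged set gives `q * m A` as a multiple of a value already known to vanish.
      by_cases hk : ∃ k : Fin (r - 1), ((k : ℕ) + 1 < a ∨ a ≤ k) ∧ lo k ∉ A ∧ hi k ∈ A
      · obtain ⟨k, hk, hl, hh⟩ := hk
        have hs := sum_exchange hl hh
        have h0 := ih _ (by omega) (exchange k A) rfl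
        rcases hk with hk | hk
        · have := congrFun (h1 k hk) (exchange k A)
          rw [fockT_apply, if_pos (lo_mem_exchange.2 hl), if_neg (by rw [hi_mem_exchange]; tauto),
            exchange_exchange, Pi.smul_apply, h0, smul_zero] at this
          exact (Units.mul_right_eq_zero q).1 this
        · have := congrFun (h2 k hk) (exchange k A)
          rw [fockT_apply, if_pos (lo_mem_exchange.2 hl), if_neg (by rw [hi_mem_exchange]; tauto),
            exchange_exchange, Pi.neg_apply, h0, neg_zero] at this
          exact (Units.mul_right_eq_zero q).1 this
      push Not at hk
      -- Two adjacent missing letters of the even block carry the eigenvalue `-1` instead of `q`;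
      -- two adjacent present letters of the odd block carry `q` instead of `-1`. Either way `(1 +
      -- q) * m A = 0`, and regularity of `1 + q` is used here. What remains is a set with at most
      -- the letter `a - 1` missing in the first block and at most the letter `a` present in the
      -- second.
      by_cases hk1 : ∃ k : Fin (r - 1), (k : ℕ) + 1 < a ∧ lo k ∉ A ∧ hi k ∉ A
      · obtain ⟨k, hk1, hl, hh⟩ := hk1
        have := congrFun (h1 k hk1) A
        rw [fockT_apply, if_neg hl, if_neg hh, Pi.smul_apply, smul_eq_mul] at this
        exact hz _ (by linear_combination -this)
      by_cases hk2 : ∃ k : Fin (r - 1), a ≤ (k : ℕ) ∧ lo k ∈ A ∧ hi k ∈ A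
      · obtain ⟨k, hk1, hl, hh⟩ := hk2
        have := congrFun (h2 k hk1) A
        rw [fockT_apply, if_pos hl, if_pos hh, Pi.neg_apply] at this
        exact hz _ (by linear_combination this)
      push Not at hk1 hk2
      apply h3
      · intro x hx
        have hxr : (x : ℕ) < r - 1 := by omega
        by_contra hxA
        exact hk ⟨x, hxr⟩ (Or.inl hx) hxA (hk1 ⟨x, hxr⟩ hx hxA)
      · intro x hx hxA
        have hxr : (x : ℕ) - 1 < r - 1 := by omega
        have e : hi (⟨(x : ℕ) - 1, hxr⟩ : Fin (r - 1)) = x := Fin.ext (by simp only [hi]; omega)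
        have hl : lo (⟨(x : ℕ) - 1, hxr⟩ : Fin (r - 1)) ∈ A := by
          by_contra hl
          exact hk ⟨(x : ℕ) - 1, hxr⟩ (Or.inr (by simp only; omega)) hl (by rwa [e])
        exact hk2 ⟨(x : ℕ) - 1, hxr⟩ (by simp only; omega) hl (by rwa [e])
  funext A
  exact key _ A rfl

theorem weightProj_vac {a : ℕ} (h : a ≤ r) (b : ℕ) :
    weightProj r R b (vac r R a) = if a = b then vac r R a else 0 := by
  funext A
  rw [weightProj_apply, vac]
  by_cases hA : A = initialSet r a
  · subst hA; rw [card_initialSet h]; split_ifs <;> rfl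
  · split_ifs <;> simp [hA]

theorem vac_eq_zero {a : ℕ} {A : Finset (Fin r)} (h : A ≠ initialSet r a) : vac r R a A = 0 := by
  simp [vac, h]

theorem vac_initialSet (a : ℕ) : vac r R a (initialSet r a) = 1 := by
  simp [vac]

theorem weight_raising {a b : ℕ} {g : Fock R r} (hg : weightProj r R a g = g)
    (hb : b = a + 1) : weightProj r R b (raising r q g) = raising r q g := by
  rw [hb, ← Module.End.mul_apply, weightProj_succ_mul_raising, Module.End.mul_apply, hg]

theorem weight_lowering {a b : ℕ} {g : Fock R r} (hg : weightProj r R a g = g)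
    (hb : b + 1 = a) : weightProj r R b (lowering r R g) = lowering r R g := by
  subst hb
  rw [← Module.End.mul_apply, weightProj_mul_lowering, Module.End.mul_apply, hg]

theorem eq_zero_of_weight {a : ℕ} {g : Fock R r} (hg : weightProj r R a g = g)
    {A : Finset (Fin r)} (hA : A.card ≠ a) : g A = 0 := by
  rw [← hg, weightProj_apply, if_neg hA]

theorem raising_apply_toggle {g : Fock R r} {i : Fin r} {A : Finset (Fin r)} (hi : i ∉ A)
    (h : ∀ j ∈ toggle i A, j ≠ i → g (toggle j (toggle i A)) = 0) :
    raising r q g (toggle i A) = ((q⁻¹ ^ (i : ℕ) : Rˣ) : R) * fockSign R i (toggle i A) * g A := by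
  rw [raising, LinearMap.sum_apply, Finset.sum_apply, Finset.sum_eq_single i]
  · rw [LinearMap.smul_apply, Pi.smul_apply, creation_apply, if_pos (mem_toggle_self.2 hi),
      toggle_toggle, smul_eq_mul, mul_assoc]
  · intro j _ hj
    rw [LinearMap.smul_apply, Pi.smul_apply, creation_apply]
    split_ifs with h'
    · rw [h j h' hj, mul_zero, smul_zero]
    · rw [smul_zero]
  · simp

theorem lowering_apply_toggle {g : Fock R r} {i : Fin r} {A : Finset (Fin r)} (hi : i ∈ A)
    (h : ∀ j ∉ toggle i A, j ≠ i → g (toggle j (toggle i A)) = 0) :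
    lowering r R g (toggle i A) = fockSign R i (toggle i A) * g A := by
  rw [lowering, LinearMap.sum_apply, Finset.sum_apply, Finset.sum_eq_single i]
  · rw [annihilation_apply, if_neg (by rw [mem_toggle_self]; tauto), toggle_toggle]
  · intro j _ hj
    rw [annihilation_apply]
    split_ifs with h'
    · rfl
    · rw [h j h' hj, mul_zero]
  · simp

theorem toggle_toggle_ne {i j : Fin r} (h : j ≠ i) (A : Finset (Fin r)) :
    toggle j (toggle i A) ≠ A := by
  intro h'
  have := congrArg (fun B => j ∈ B) h'
  simp only [mem_toggle_self, mem_toggle_of_ne h, eq_iff_iff] at this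
  tauto

theorem isUnit_fockSign (i : Fin r) (A : Finset (Fin r)) : IsUnit (fockSign R i A) :=
  IsUnit.of_mul_eq_one _ (fockSign_mul_self R i A)

theorem isUnit_raising_vac {a : ℕ} (h : a < r) :
    IsUnit (raising r q (vac r R a) (toggle ⟨a, h⟩ (initialSet r a))) := by
  rw [raising_apply_toggle q (by simp [mem_initialSet])
    fun j _ hj => vac_eq_zero (toggle_toggle_ne hj _), vac_initialSet, mul_one]
  exact (Units.isUnit _).mul (isUnit_fockSign _ _)

theorem isUnit_lowering_vac {a : ℕ} (h : a < r) :
    IsUnit (lowering r R (vac r R (a + 1)) (toggle ⟨a, h⟩ (initialSet r (a + 1)))) := by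
  rw [lowering_apply_toggle (by simp [mem_initialSet])
    fun j _ hj => vac_eq_zero (toggle_toggle_ne hj _), vac_initialSet, mul_one]
  exact isUnit_fockSign _ _

/-- The set in question arises from the initial set only by removing its last letter and adding the
next one, so a single term contributes and it is a product of signs and a power of `q`. -/
theorem isUnit_raising_lowering_vac {a : ℕ} (h : a + 1 < r) :
    IsUnit (raising r q (lowering r R (vac r R (a + 1)))
      (toggle ⟨a + 1, h⟩ (toggle ⟨a, by omega⟩ (initialSet r (a + 1))))) := by
  rw [raising_apply_toggle q]
  · exact ((Units.isUnit _).mul (isUnit_fockSign _ _)).mul (isUnit_lowering_vac _)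
  · simp [mem_toggle, mem_initialSet]
  · intro j _ hj
    rw [lowering, LinearMap.sum_apply, Finset.sum_apply]
    refine Finset.sum_eq_zero fun i _ => ?_
    rw [annihilation_apply]
    split_ifs with hi
    · rfl
    · rw [vac_eq_zero, mul_zero]
      intro h'
      have h1 : (⟨a + 1, h⟩ : Fin r) ∉ initialSet r (a + 1) := by simp [mem_initialSet]
      rw [← h'] at h1
      have h2 : (⟨a + 1, h⟩ : Fin r) ∈ toggle j (toggle ⟨a + 1, h⟩
          (toggle ⟨a, by omega⟩ (initialSet r (a + 1)))) := by
        rw [mem_toggle_of_ne hj.symm, mem_toggle_self]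
        simp [mem_toggle, mem_initialSet]
      by_cases hia : (⟨a + 1, h⟩ : Fin r) = i
      · rw [← hia] at hi; exact hi h2
      · rw [mem_toggle_of_ne hia] at h1; exact h1 h2

/-- Only the letters `a - 1` and `a` are free, which leaves four sets. They match the four vectors
`vac a`, `E vac a`, `F vac a`, `E F vac a`. -/
theorem near_initialSet {a : ℕ} (ha : a ≤ r) {A : Finset (Fin r)}
    (h1 : ∀ x : Fin r, (x : ℕ) + 1 < a → x ∈ A) (h2 : ∀ x : Fin r, a < x → x ∉ A) :
    A = initialSet r a ∨ (∃ h : a < r, A = toggle ⟨a, h⟩ (initialSet r a)) ∨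
      (∃ b, ∃ h : b < r, a = b + 1 ∧ A = toggle ⟨b, h⟩ (initialSet r a)) ∨
      ∃ b, ∃ h : b + 1 < r, a = b + 1 ∧
        A = toggle ⟨b + 1, h⟩ (toggle ⟨b, by omega⟩ (initialSet r a)) := by
  by_cases hP : ∀ x : Fin r, (x : ℕ) < a → x ∈ A <;> by_cases hQ : ∀ x : Fin r, a ≤ x → x ∉ A
  · left
    ext x; rw [mem_initialSet]
    exact ⟨fun hx => by by_contra h; exact hQ x (by omega) hx, hP x⟩
  · right; left
    push Not at hQ
    obtain ⟨y, hy, hyA⟩ := hQ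
    have hya : (y : ℕ) = a := by
      by_contra h; exact h2 y (by omega) hyA
    subst hya
    refine ⟨y.2, ?_⟩
    ext x; rw [mem_toggle, mem_initialSet]
    rcases lt_trichotomy (x : ℕ) y with h | h | h
    · have := hP x h; have h' : x ≠ y := fun e => by subst e; omega
      simp [*]
    · have h' : x = y := Fin.ext h
      subst h'; simp [*]
    · have := h2 x h; have h' : x ≠ y := fun e => by subst e; omega
      simp [this, h', h.not_gt]
  · right; right; left
    push Not at hP
    obtain ⟨y, hy, hyA⟩ := hP
    have hya : a = (y : ℕ) + 1 := by
      by_contra h; exact hyA (h1 y (by omega))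
    subst hya
    refine ⟨y, y.2, rfl, ?_⟩
    ext x; rw [mem_toggle, mem_initialSet]
    rcases lt_trichotomy (x : ℕ) y with h | h | h
    · have := h1 x (by omega); have h' : x ≠ y := fun e => by subst e; omega
      simp [this, h']; omega
    · have h' : x = y := Fin.ext h
      subst h'; simp [*]
    · have := hQ x (by omega); have h' : x ≠ y := fun e => by subst e; omega
      simp [this, h']; omega
  · right; right; right
    push Not at hP hQ
    obtain ⟨y, hy, hyA⟩ := hP
    have hya : a = (y : ℕ) + 1 := by
      by_contra h; exact hyA (h1 y (by omega))
    subst hya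
    obtain ⟨z, hz, hzA⟩ := hQ
    have hza : (y : ℕ) + 1 = (z : ℕ) := by
      by_contra h; exact h2 z (by omega) hzA
    have hz' : z = ⟨y + 1, hza ▸ z.2⟩ := Fin.ext hza.symm
    refine ⟨y, hza ▸ z.2, rfl, ?_⟩
    rw [← hz']
    ext x; rw [mem_toggle, mem_toggle, mem_initialSet]
    by_cases hxz : x = z
    · subst hxz
      have : x ≠ y := fun e => by rw [e] at hza; omega
      simp [hzA, this]; omega
    · have := Fin.val_ne_of_ne hxz
      rcases lt_trichotomy (x : ℕ) y with h | h | h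
      · have := h1 x (by omega); have h' : x ≠ y := fun e => by subst e; omega
        simp [this, h', hxz]; omega
      · have h' : x = y := Fin.ext h
        subst h'; simp [hyA, hxz]
      · have := h2 x (by omega); have h' : x ≠ y := fun e => by subst e; omega
        simp [this, h', hxz]; omega

theorem exists_mul_eq_of_isUnit {u : R} (h : IsUnit u) (x : R) : ∃ y, y * u = x :=
  ⟨x * ↑h.unit⁻¹, by rw [mul_assoc, h.val_inv_mul, mul_one]⟩

/-- The eigenvectors of the operators `T_s` with the eigenvalues of `vac a`. -/
theorem exists_eq_of_eigen (hq : 1 + (q : R) ∈ nonZeroDivisors R) {a : ℕ} (ha : a ≤ r)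
    {m : Fock R r}
    (h1 : ∀ k : Fin (r - 1), (k : ℕ) + 1 < a → fockT q k m = (q : R) • m)
    (h2 : ∀ k : Fin (r - 1), a ≤ k → fockT q k m = -m) :
    ∃ α β γ δ : R, m = α • vac r R a + β • raising r q (vac r R a) +
      γ • lowering r R (vac r R a) + δ • raising r q (lowering r R (vac r R a)) := by
  -- The coefficients `β`, `γ`, `δ` are read off at the three neighbouring sets, where the matching
  -- vector has a unit coordinate. They are `0` by default where the neighbouring set does not
  -- exist, that is at the ends `a = r` or `a = 0`.
  obtain ⟨β, hβ⟩ : ∃ β, ∀ h : a < r, β * raising r q (vac r R a) (toggle ⟨a, h⟩ (initialSet r a)) =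
      m (toggle ⟨a, h⟩ (initialSet r a)) := by
    by_cases h : a < r
    · obtain ⟨β, hβ⟩ := exists_mul_eq_of_isUnit (isUnit_raising_vac q h)
        (m (toggle ⟨a, h⟩ (initialSet r a)))
      exact ⟨β, fun _ => hβ⟩
    · exact ⟨0, fun h' => absurd h' h⟩
  obtain ⟨γ, hγ⟩ : ∃ γ, ∀ b, ∀ h : b < r, a = b + 1 →
      γ * lowering r R (vac r R a) (toggle ⟨b, h⟩ (initialSet r a)) =
      m (toggle ⟨b, h⟩ (initialSet r a)) := by
    obtain _ | b := a
    · exact ⟨0, fun b _ h => by omega⟩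
    · obtain ⟨γ, hγ⟩ := exists_mul_eq_of_isUnit (isUnit_lowering_vac (R := R) (a := b) ha)
        (m (toggle ⟨b, ha⟩ (initialSet r (b + 1))))
      refine ⟨γ, fun b' _ hb => ?_⟩
      obtain rfl : b' = b := by omega
      exact hγ
  obtain ⟨δ, hδ⟩ : ∃ δ, ∀ b, ∀ h : b + 1 < r, a = b + 1 →
      δ * raising r q (lowering r R (vac r R a))
        (toggle ⟨b + 1, h⟩ (toggle ⟨b, by omega⟩ (initialSet r a))) =
      m (toggle ⟨b + 1, h⟩ (toggle ⟨b, by omega⟩ (initialSet r a))) := by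
    by_cases h : ∃ b, b + 1 < r ∧ a = b + 1
    · obtain ⟨b, hb, rfl⟩ := h
      obtain ⟨δ, hδ⟩ := exists_mul_eq_of_isUnit (isUnit_raising_lowering_vac q hb)
        (m (toggle ⟨b + 1, hb⟩ (toggle ⟨b, by omega⟩ (initialSet r (b + 1)))))
      refine ⟨δ, fun b' _ hb => ?_⟩
      obtain rfl : b' = b := by omega
      exact hδ
    · exact ⟨0, fun b hb hb' => absurd ⟨b, hb, hb'⟩ h⟩
  set p := vac r R a with hp
  -- The vector `E F vac a` may also have a coordinate at the initial set, which has to be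
  -- subtracted.
  set α := m (initialSet r a) - δ * raising r q (lowering r R p) (initialSet r a) with hα
  refine ⟨α, β, γ, δ, ?_⟩
  have comm {φ : Module.End R (Fock R r)} {k : Fin (r - 1)} {c : R} {g : Fock R r}
      (hφ : φ * fockT q k = fockT q k * φ) (hg : fockT q k g = c • g) :
      fockT q k (φ g) = c • φ g := by
    rw [← Module.End.mul_apply, ← hφ, Module.End.mul_apply, hg, map_smul]
  have eig : ∀ (k : Fin (r - 1)) (c : R), fockT q k m = c • m → fockT q k p = c • p →
      fockT q k (m - (α • p + β • raising r q p + γ • lowering r R p +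
        δ • raising r q (lowering r R p))) = c • (m - (α • p + β • raising r q p +
        γ • lowering r R p + δ • raising r q (lowering r R p))) := by
    intro k c hm hg
    simp only [map_sub, map_add, map_smul, hm, hg, comm (raising_comm_fockT q k) hg,
      comm (lowering_comm_fockT q k) hg,
      comm (raising_comm_fockT q k) (comm (lowering_comm_fockT q k) hg)]
    module
  have wp : weightProj r R a p = p := by rw [hp, weightProj_vac ha, if_pos rfl]
  have wE := weight_raising q wp rfl
  have c0 := card_initialSet ha
  have zF : ∀ A : Finset (Fin r), A.card + 1 ≠ a → lowering r R p A = 0 := by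
    intro A hA
    obtain _ | b := a
    · have : lowering r R p = 0 := by
        rw [← wp, ← Module.End.mul_apply, lowering_mul_weightProj_zero]; rfl
      rw [this]; rfl
    · exact eq_zero_of_weight (weight_lowering wp rfl) (by omega)
  have zEF : ∀ A : Finset (Fin r), A.card ≠ a → raising r q (lowering r R p) A = 0 := by
    intro A hA
    obtain _ | b := a
    · have : lowering r R p = 0 := by
        rw [← wp, ← Module.End.mul_apply, lowering_mul_weightProj_zero]; rfl
      rw [this, map_zero]; rfl
    · exact eq_zero_of_weight (weight_raising q (weight_lowering wp rfl) rfl) hA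
  rw [← sub_eq_zero]
  refine eq_zero_of_eigen q hq ha (fun k hk => eig k _ (h1 k hk) (fockT_vac_of_lt q hk))
    (fun k hk => ?_) fun A hA1 hA2 => ?_
  · have := eig k (-1) (by rw [h2 k hk]; module) (by rw [hp, fockT_vac_of_le q hk]; module)
    rw [this]; module
  -- By weight or by support, at each of the four sets every vector not used to fix a coefficient
  -- vanishes, except for the correction built into `α`.
  · simp only [Pi.sub_apply, Pi.add_apply, Pi.smul_apply, smul_eq_mul]
    rcases near_initialSet ha hA1 hA2 with rfl | ⟨h, rfl⟩ | ⟨b, h, hb, rfl⟩ | ⟨b, h, hb, rfl⟩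
    · rw [eq_zero_of_weight wE (by omega), zF _ (by omega), hp, vac_initialSet, ← hp, hα]
      ring
    · have hc := card_toggle_of_notMem (i := ⟨a, h⟩) (A := initialSet r a)
        (by simp [mem_initialSet])
      rw [eq_zero_of_weight wp (by omega), zF _ (by omega), zEF _ (by omega), hβ]
      ring
    · have hc := card_toggle_of_mem (i := ⟨b, h⟩) (A := initialSet r a)
        (by simp [mem_initialSet, hb])
      rw [eq_zero_of_weight wp (by omega), eq_zero_of_weight wE (by omega), zEF _ (by omega),
        hγ b h hb]
      ring
    · have hc := card_toggle_of_mem (i := ⟨b, by omega⟩) (A := initialSet r a)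
        (by simp [mem_initialSet, hb])
      have hc' := card_toggle_of_notMem (i := ⟨b + 1, h⟩)
        (A := toggle ⟨b, by omega⟩ (initialSet r a)) (by simp [mem_toggle, mem_initialSet, hb])
      rw [eq_zero_of_weight wE (by omega), zF _ (by omega), hδ b h hb, hp,
        vac_eq_zero (toggle_toggle_ne (by simp [Fin.ext_iff]) _)]
      ring

end Commutant

/-! ### The commutant -/

/-- The algebra `A` is spanned by the elements `e a`, `E * e a`, `F * e a`, `E * F * e a`, where the
`e a` are idempotents that decompose the identity, and `E` and `F` satisfy the relations of the
superalgebra `gl(1|1)` with the central element `c`. The coordinates say that the `e a`, and the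
`F * e a` with `0 < a`, are unimodular. -/
structure IsRankOneSchur {R A : Type*} [CommRing R] [Ring A] [Algebra R A] (r : ℕ) (c : R)
    (e : ℕ → A) (E F : A) : Prop where
  e_mul_e : ∀ a b, e a * e b = if a = b then e a else 0
  sum_e : ∑ a ∈ Finset.range (r + 1), e a = 1
  e_mul_E : ∀ a, e (a + 1) * E = E * e a
  e_mul_F : ∀ a, e a * F = F * e (a + 1)
  E_mul_E : E * E = 0
  F_mul_F : F * F = 0
  anticomm : E * F + F * E = algebraMap R A c
  exists_eq_sum : ∀ x, ∃ α β γ δ : ℕ → R, x = ∑ a ∈ Finset.range (r + 1),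
    (α a • e a + β a • (E * e a) + γ a • (F * e a) + δ a • (E * F * e a))
  exists_coord_e : ∀ a ≤ r, ∃ f : A →ₗ[R] R, f (e a) = 1
  exists_coord_F : ∀ a < r, ∃ f : A →ₗ[R] R, f (F * e (a + 1)) = 1

section

variable {R : Type*} [CommRing R] (q : Rˣ) (r : ℕ)

/-- The algebra of all operators on the Fock space that commute with the action of the `T_s`. -/
abbrev fockCommutant : Subalgebra R (Module.End R (Fock R r)) :=
  Subalgebra.centralizer R (Set.range (fockT (r := r) q))

variable {r}

theorem mem_fockCommutant {φ : Module.End R (Fock R r)} :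
    φ ∈ fockCommutant q r ↔ ∀ k, φ * fockT q k = fockT q k * φ := by
  rw [Subalgebra.mem_centralizer_iff]
  constructor
  · exact fun h k => (h _ ⟨k, rfl⟩).symm
  · rintro h _ ⟨k, rfl⟩
    exact (h k).symm

/-- A matrix coefficient, divided by its unit value, is a functional with value `1`. -/
theorem exists_coord_of_isUnit {S : Subalgebra R (Module.End R (Fock R r))} (x : S) (g : Fock R r)
    (A : Finset (Fin r)) (h : IsUnit (x.1 g A)) : ∃ f : S →ₗ[R] R, f x = 1 := by
  refine ⟨(↑h.unit⁻¹ : R) • (LinearMap.proj A ∘ₗ LinearMap.applyₗ g ∘ₗ S.val.toLinearMap), ?_⟩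
  exact h.val_inv_mul

theorem isRankOneSchur_fockCommutant (hq : 1 + (q : R) ∈ nonZeroDivisors R) :
    IsRankOneSchur (A := fockCommutant q r) r (∑ i ∈ Finset.range r, ((q⁻¹ ^ i : Rˣ) : R))
      (fun a => ⟨weightProj r R a, (mem_fockCommutant q).2 (weightProj_comm_fockT q a)⟩)
      ⟨raising r q, (mem_fockCommutant q).2 (raising_comm_fockT q)⟩
      ⟨lowering r R, (mem_fockCommutant q).2 (lowering_comm_fockT q)⟩ where
  e_mul_e a b := by
    apply Subtype.ext
    refine (weightProj_mul_weightProj a b).trans ?_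
    split_ifs <;> rfl
  sum_e := by
    apply Subtype.ext
    rw [AddSubmonoidClass.coe_finsetSum]
    exact sum_weightProj
  e_mul_E a := Subtype.ext (weightProj_succ_mul_raising q a)
  e_mul_F a := Subtype.ext (weightProj_mul_lowering a)
  E_mul_E := Subtype.ext (raising_mul_self q)
  F_mul_F := Subtype.ext lowering_mul_self
  anticomm := Subtype.ext (raising_lowering_add q)
  exists_eq_sum x := by
    have hx := (mem_fockCommutant q).1 x.2
    -- The image of `vac a` has the same `T_s`-eigenvalues as `vac a`, so the classification of
    -- eigenvectors applies. The bound is placed inside so that the coefficients can be chosen for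
    -- all `a` at once.
    have h : ∀ a, ∃ α β γ δ : R, a ≤ r → x.1 (vac r R a) = α • vac r R a +
        β • raising r q (vac r R a) + γ • lowering r R (vac r R a) +
        δ • raising r q (lowering r R (vac r R a)) := by
      intro a
      by_cases ha : a ≤ r
      · obtain ⟨α, β, γ, δ, h⟩ := exists_eq_of_eigen q hq ha (m := x.1 (vac r R a))
          (fun k hk => by
            rw [← Module.End.mul_apply, ← hx, Module.End.mul_apply, fockT_vac_of_lt q hk, map_smul])
          (fun k hk => by
            rw [← Module.End.mul_apply, ← hx, Module.End.mul_apply, fockT_vac_of_le q hk, map_neg])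
        exact ⟨α, β, γ, δ, fun _ => h⟩
      · exact ⟨0, 0, 0, 0, fun h => absurd h ha⟩
    choose α β γ δ h using h
    refine ⟨α, β, γ, δ, Subtype.ext (eq_of_vac q hx ((mem_fockCommutant q).1 (Subtype.prop _)) ?_)⟩
    intro b hb
    rw [h b hb, AddSubmonoidClass.coe_finsetSum, LinearMap.sum_apply, Finset.sum_eq_single b]
    · simp [weightProj_vac hb]
    · intro a _ hab
      simp [weightProj_vac hb, hab.symm]
    · intro hb'
      exact absurd (Finset.mem_range.2 (by omega)) hb'
  exists_coord_e a ha := exists_coord_of_isUnit _ (vac r R a) (initialSet r a) (by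
    simp [weightProj_vac ha, vac_initialSet])
  exists_coord_F a ha := exists_coord_of_isUnit _ (vac r R (a + 1))
    (toggle ⟨a, ha⟩ (initialSet r (a + 1))) (by
      have := isUnit_lowering_vac (R := R) ha
      simpa [weightProj_vac ha] using this)

end

/-! ### Commutants over an algebra given by generators -/

section Generators

variable {R S M V ι : Type*} [CommRing R] [Ring S] [Algebra R S] [AddCommGroup M] [Module R M]
  [Module S M] [IsScalarTower R S M] [AddCommGroup V] [Module R V]

theorem map_smul_of_adjoin_eq_top {x : ι → S} (hx : Algebra.adjoin R (Set.range x) = ⊤)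
    {f : M →ₗ[R] M} (hf : ∀ i m, f (x i • m) = x i • f m) (s : S) (m : M) :
    f (s • m) = s • f m := by
  have hs : s ∈ Algebra.adjoin R (Set.range x) := by rw [hx]; trivial
  induction hs using Algebra.adjoin_induction generalizing m with
  | mem s hs => obtain ⟨i, rfl⟩ := hs; exact hf i m
  | algebraMap c => rw [algebraMap_smul, algebraMap_smul, map_smul]
  | add a b _ _ ha hb => rw [add_smul, add_smul, map_add, ha, hb]
  | mul a b _ _ ha hb => rw [mul_smul, mul_smul, ha, hb]

variable [SMulCommClass S R M]

/-- The endomorphisms of a module over an algebra with generators `x i` are the operators that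
commute with the operators by which the `x i` act. -/
def endEquivCentralizer {x : ι → S} (hx : Algebra.adjoin R (Set.range x) = ⊤)
    (Ψ : V ≃ₗ[R] M) (t : ι → Module.End R V) (ht : ∀ i v, Ψ (t i v) = x i • Ψ v) :
    Module.End S M ≃ₐ[R] Subalgebra.centralizer R (Set.range t) where
  toFun φ := ⟨Ψ.symm.toLinearMap ∘ₗ φ.restrictScalars R ∘ₗ Ψ.toLinearMap, by
    rw [Subalgebra.mem_centralizer_iff]
    rintro _ ⟨i, rfl⟩
    refine LinearMap.ext fun v => Ψ.injective ?_
    simp [Module.End.mul_apply, ht]⟩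
  invFun y :=
    { toFun := fun m => Ψ (y.1 (Ψ.symm m))
      map_add' := by simp
      map_smul' := by
        refine map_smul_of_adjoin_eq_top hx
          (f := Ψ.toLinearMap ∘ₗ y.1 ∘ₗ Ψ.symm.toLinearMap) fun i m => ?_
        have h := (Subalgebra.mem_centralizer_iff R).1 y.2 _ ⟨i, rfl⟩
        obtain ⟨v, rfl⟩ := Ψ.surjective m
        rw [← ht]
        simp only [LinearMap.comp_apply, LinearEquiv.coe_coe, LinearEquiv.symm_apply_apply]
        rw [← ht, ← Module.End.mul_apply, ← h, Module.End.mul_apply] }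
  left_inv φ := by ext m; simp
  right_inv y := by
    apply Subtype.ext
    refine LinearMap.ext fun v => ?_
    simp
  map_mul' φ ψ := by
    apply Subtype.ext
    refine LinearMap.ext fun v => ?_
    simp [Module.End.mul_apply]
  map_add' φ ψ := by
    apply Subtype.ext
    refine LinearMap.ext fun v => ?_
    simp
  commutes' c := by
    apply Subtype.ext
    refine LinearMap.ext fun v => ?_
    simp [Module.algebraMap_end_apply]

end Generators

/-! ### The Hecke algebra and the Fock space -/

section

variable {r : ℕ}

theorem invSet_mul_simpleRefl (w : Equiv.Perm (Fin r)) (k : Fin (r - 1))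
    (h : w (lo k) < w (hi k)) :
    invSet (w * simpleRefl k) = insert (lo k, hi k)
      ((invSet w).image fun p => (simpleRefl k p.1, simpleRefl k p.2)) := by
  have hss : ∀ a, simpleRefl k (simpleRefl k a) = a := Equiv.swap_apply_self _ _
  have hlt : ∀ a b : Fin r, a < b → ¬ ((a : ℕ) = k ∧ (b : ℕ) = k + 1) →
      simpleRefl k a < simpleRefl k b := by
    intro a b hab hne
    rw [Fin.lt_def] at hab ⊢
    rw [simpleRefl_apply, simpleRefl_apply]
    split_ifs <;> omega
  have hk0 : simpleRefl k (lo k) = hi k := Equiv.swap_apply_left _ _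
  have hk1 : simpleRefl k (hi k) = lo k := Equiv.swap_apply_right _ _
  ext ⟨a, b⟩
  simp only [mem_invSet, Finset.mem_insert, Finset.mem_image, Prod.mk.injEq, Prod.exists,
    Equiv.Perm.mul_apply]
  constructor
  · rintro ⟨hab, hw⟩
    by_cases hc : (a : ℕ) = k ∧ (b : ℕ) = k + 1
    · exact Or.inl ⟨Fin.ext hc.1, Fin.ext hc.2⟩
    · exact Or.inr ⟨_, _, ⟨hlt a b hab hc, hw⟩, hss a, hss b⟩
  · rintro (⟨rfl, rfl⟩ | ⟨c, d, ⟨hcd, hw⟩, rfl, rfl⟩)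
    · rw [hk0, hk1]; exact ⟨lo_lt_hi k, h⟩
    · rw [hss, hss]
      refine ⟨hlt c d hcd ?_, hw⟩
      rintro ⟨h1, h2⟩
      rw [show c = lo k from Fin.ext h1, show d = hi k from Fin.ext h2] at hw
      exact lt_asymm h hw

/-- The number of inversions of `w` between values that are at least `a`. -/
def oddInv (a : ℕ) (w : Equiv.Perm (Fin r)) : ℕ :=
  ((invSet w).filter fun p => a ≤ (w p.2 : ℕ)).card

/-- Multiplication by an ascent transports the old inversions with their values and adds the pair
`(k, k + 1)`, whose smaller value is `w (lo k)`. -/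
theorem oddInv_mul_simpleRefl (a : ℕ) (w : Equiv.Perm (Fin r)) (k : Fin (r - 1))
    (h : w (lo k) < w (hi k)) :
    oddInv a (w * simpleRefl k) = oddInv a w + if a ≤ (w (lo k) : ℕ) then 1 else 0 := by
  have hss : ∀ x, simpleRefl k (simpleRefl k x) = x := Equiv.swap_apply_self _ _
  have hk0 : simpleRefl k (lo k) = hi k := Equiv.swap_apply_left _ _
  have hk1 : simpleRefl k (hi k) = lo k := Equiv.swap_apply_right _ _
  rw [oddInv, oddInv, invSet_mul_simpleRefl w k h, Finset.filter_insert, Finset.filter_image]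
  simp only [Equiv.Perm.mul_apply, hss, hk1]
  have hc : (((invSet w).filter fun p => a ≤ (w p.2 : ℕ)).image
      fun p => (simpleRefl k p.1, simpleRefl k p.2)).card =
      ((invSet w).filter fun p => a ≤ (w p.2 : ℕ)).card := by
    apply Finset.card_image_of_injective
    rintro ⟨x, y⟩ ⟨z, t⟩ he
    simpa using he
  split_ifs
  · rw [Finset.card_insert_of_notMem, hc]
    simp only [Finset.mem_image, Finset.mem_filter, mem_invSet, Prod.mk.injEq, Prod.exists,
      not_exists]
    rintro c d ⟨⟨⟨hcd, -⟩, -⟩, h1, h2⟩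
    rw [← hss c, ← hss d, h1, h2, hk0, hk1] at hcd
    exact lt_asymm hcd (lo_lt_hi k)
  · rw [hc, add_zero]

/-- The set of the letters that `w` sends to the first `a` letters. -/
def colSet (a : ℕ) (w : Equiv.Perm (Fin r)) : Finset (Fin r) :=
  Finset.univ.filter fun x => (w x : ℕ) < a

theorem mem_colSet {a : ℕ} {w : Equiv.Perm (Fin r)} {x : Fin r} :
    x ∈ colSet a w ↔ (w x : ℕ) < a := by
  simp [colSet]

theorem card_colSet {a : ℕ} (ha : a ≤ r) (w : Equiv.Perm (Fin r)) : (colSet a w).card = a := by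
  have : colSet a w = (initialSet r a).map w⁻¹.toEmbedding := by
    ext x
    rw [mem_colSet, Finset.mem_map_equiv, mem_initialSet]
    rfl
  rw [this, Finset.card_map, card_initialSet ha]

theorem mem_colSet_mul_simpleRefl {a : ℕ} {w : Equiv.Perm (Fin r)} {k : Fin (r - 1)} {x : Fin r} :
    x ∈ colSet a (w * simpleRefl k) ↔
      if x = lo k then hi k ∈ colSet a w else if x = hi k then lo k ∈ colSet a w
      else x ∈ colSet a w := by
  simp only [mem_colSet, Equiv.Perm.mul_apply, simpleRefl, Equiv.swap_apply_def]
  split_ifs <;> rfl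

theorem colSet_mul_simpleRefl_of_iff {a : ℕ} {w : Equiv.Perm (Fin r)} {k : Fin (r - 1)}
    (h : lo k ∈ colSet a w ↔ hi k ∈ colSet a w) : colSet a (w * simpleRefl k) = colSet a w := by
  ext x
  rw [mem_colSet_mul_simpleRefl]
  split_ifs with h1 h2
  · rw [h1, h]
  · rw [h2, h]
  · rfl

theorem colSet_mul_simpleRefl_of_not_iff {a : ℕ} {w : Equiv.Perm (Fin r)} {k : Fin (r - 1)}
    (h : lo k ∈ colSet a w ↔ hi k ∉ colSet a w) :
    colSet a (w * simpleRefl k) = exchange k (colSet a w) := by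
  ext x
  rw [mem_colSet_mul_simpleRefl]
  split_ifs with h1 h2
  · rw [h1, lo_mem_exchange]; tauto
  · rw [h2, hi_mem_exchange]; tauto
  · rw [exchange, mem_toggle_of_ne h1, mem_toggle_of_ne h2]

variable {R : Type*} [CommRing R] (q : Rˣ)

/-- The defining formula says where basis vectors go; this is its transpose, describing coordinates.
Both sides are linear in `f`, so the check is on basis vectors. -/
theorem rightOp_apply (k : Fin (r - 1)) (f : Equiv.Perm (Fin r) → R) (w : Equiv.Perm (Fin r)) :
    rightOp R q r k f w = if w (lo k) < w (hi k) then (q : R) * f (w * simpleRefl k)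
      else f (w * simpleRefl k) + ((q : R) - 1) * f w := by
  let g : (Equiv.Perm (Fin r) → R) →ₗ[R] R :=
    if w (lo k) < w (hi k) then (q : R) • LinearMap.proj (w * simpleRefl k)
    else LinearMap.proj (w * simpleRefl k) + ((q : R) - 1) • LinearMap.proj w
  have hg : ∀ f, g f = if w (lo k) < w (hi k) then (q : R) * f (w * simpleRefl k)
      else f (w * simpleRefl k) + ((q : R) - 1) * f w := by
    intro f
    simp only [g]
    split_ifs <;> simp
  rw [← hg]
  have hk0 : simpleRefl k (lo k) = hi k := Equiv.swap_apply_left _ _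
  have hk1 : simpleRefl k (hi k) = lo k := Equiv.swap_apply_right _ _
  have : LinearMap.proj w ∘ₗ rightOp R q r k = g := by
    apply (Pi.basisFun R (Equiv.Perm (Fin r))).ext
    intro v
    rw [Pi.basisFun_apply, LinearMap.comp_apply, HeckeAlgebra.rightOp_single, hg,
      LinearMap.proj_apply]
    simp only [length_lt_mul_iff]
    have hs : w = v * simpleRefl k ↔ w * simpleRefl k = v := by
      constructor
      · rintro rfl; rw [mul_assoc, simpleRefl_mul_self, mul_one]
      · rintro rfl; rw [mul_assoc, simpleRefl_mul_self, mul_one]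
    have hns : ¬ v = v * simpleRefl k := fun h => by
      have := congrArg (fun u => u (lo k)) h
      simp only [Equiv.Perm.mul_apply, hk0] at this
      exact apply_ne v k this
    by_cases h1 : w = v
    · subst h1
      have h2 : ¬ w * simpleRefl k = w := fun h => hns h.symm
      split_ifs <;> simp [hns, h2]
    · by_cases h2 : w * simpleRefl k = v
      · have h3 := hs.2 h2
        subst h2
        have := apply_ne w k
        simp only [Equiv.Perm.mul_apply, hk0, hk1]
        rcases lt_or_gt_of_ne this with h | h
        · simp [h, h.not_gt, mul_assoc, simpleRefl_mul_self, h1]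
        · simp [h, h.not_gt, mul_assoc, simpleRefl_mul_self, h1]
      · have h3 : ¬ w = v * simpleRefl k := fun h => h2 (hs.1 h)
        split_ifs <;> simp [h1, h2, h3]
  exact congrArg (fun l : _ →ₗ[R] R => l f) this

/-- The embedding of the part of the Fock space with `a` letters into the right regular module. -/
def fockToFun (a : ℕ) : Fock R r →ₗ[R] (Equiv.Perm (Fin r) → R) where
  toFun g w := (((-q)⁻¹ ^ oddInv a w : Rˣ) : R) * g (colSet a w)
  map_add' g h := by ext w; simp [mul_add]
  map_smul' c g := by ext w; simp [mul_left_comm]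

theorem fockToFun_apply (a : ℕ) (g : Fock R r) (w : Equiv.Perm (Fin r)) :
    fockToFun q a g w = (((-q)⁻¹ ^ oddInv a w : Rˣ) : R) * g (colSet a w) := rfl

/-- The membership of `k` and `k + 1` in `colSet a w` records whether `w` sends them below `a`, so
each case of `fockT` meets one case of `rightOp`. If both values are at least `a`, the weight
changes by `(-q)⁻¹`, and `q * (-q)⁻¹ = -1` produces the sign eigenvalue. In all other cases the
weight does not change. -/
theorem rightOp_fockToFun (a : ℕ) (k : Fin (r - 1)) (g : Fock R r) :
    rightOp R q r k (fockToFun q a g) = fockToFun q a (fockT q k g) := by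
  funext w
  have hk0 : simpleRefl k (lo k) = hi k := Equiv.swap_apply_left _ _
  have hk1 : simpleRefl k (hi k) = lo k := Equiv.swap_apply_right _ _
  have hu : (q : R) * (((-q)⁻¹ : Rˣ) : R) = -1 := by
    rw [inv_neg, Units.val_neg, mul_neg, Units.mul_inv]
  simp only [rightOp_apply, fockToFun_apply, fockT_apply]
  rcases lt_or_gt_of_ne (apply_ne w k) with h | h
  · have hn := oddInv_mul_simpleRefl a w k h
    rw [if_pos h, hn]
    by_cases h1 : (w (lo k) : ℕ) < a
    · have h1' : lo k ∈ colSet a w := mem_colSet.2 h1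
      rw [if_neg h1.not_ge, add_zero, if_pos h1']
      by_cases h2 : (w (hi k) : ℕ) < a
      · have h2' : hi k ∈ colSet a w := mem_colSet.2 h2
        rw [if_pos h2', colSet_mul_simpleRefl_of_iff (by tauto)]
        ring
      · have h2' : hi k ∉ colSet a w := fun h => h2 (mem_colSet.1 h)
        rw [if_neg h2', colSet_mul_simpleRefl_of_not_iff (by tauto)]
        ring
    · have h1' : lo k ∉ colSet a w := fun h => h1 (mem_colSet.1 h)
      have h2' : hi k ∉ colSet a w := fun h' => by
        have := mem_colSet.1 h'
        rw [Fin.lt_def] at h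
        omega
      rw [if_pos (not_lt.1 h1), if_neg h1', if_neg h2', colSet_mul_simpleRefl_of_iff (by tauto),
        pow_succ, Units.val_mul]
      linear_combination (((-q)⁻¹ ^ oddInv a w : Rˣ) : R) * g (colSet a w) * hu
  · have hn := oddInv_mul_simpleRefl a (w * simpleRefl k) k (by
      rw [Equiv.Perm.mul_apply, Equiv.Perm.mul_apply, hk0, hk1]; exact h)
    rw [mul_assoc, simpleRefl_mul_self, mul_one, Equiv.Perm.mul_apply, hk0] at hn
    rw [if_neg h.not_gt, hn]
    by_cases h1 : (w (hi k) : ℕ) < a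
    · have h1' : hi k ∈ colSet a w := mem_colSet.2 h1
      rw [if_neg h1.not_ge, add_zero, if_pos h1']
      by_cases h2 : (w (lo k) : ℕ) < a
      · have h2' : lo k ∈ colSet a w := mem_colSet.2 h2
        rw [if_pos h2', colSet_mul_simpleRefl_of_iff (by tauto)]
        ring
      · have h2' : lo k ∉ colSet a w := fun h => h2 (mem_colSet.1 h)
        rw [if_neg h2', if_pos h1', colSet_mul_simpleRefl_of_not_iff (by tauto)]
        ring
    · have h1' : hi k ∉ colSet a w := fun h => h1 (mem_colSet.1 h)
      have h2' : lo k ∉ colSet a w := fun h' => by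
        have := mem_colSet.1 h'
        rw [Fin.lt_def] at h
        omega
      rw [if_pos (not_lt.1 h1), if_neg h2', if_neg h1', colSet_mul_simpleRefl_of_iff (by tauto),
        pow_succ, Units.val_mul]
      linear_combination
        (((-q)⁻¹ ^ oddInv a (w * simpleRefl k) : Rˣ) : R) * g (colSet a w) * hu

end

/-! ### ### The Fock space inside the Hecke algebra -/

section

variable {r : ℕ} {R : Type*} [CommRing R] (q : Rˣ)

theorem T_mul_simpleRefl {w : Equiv.Perm (Fin r)} {k : Fin (r - 1)} (h : w (lo k) < w (hi k)) :
    HeckeAlgebra.T (R := R) q (w * simpleRefl k) =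
      HeckeAlgebra.T q w * HeckeAlgebra.T q (simpleRefl k) := by
  rw [HeckeAlgebra.T_mul_T, if_pos ((length_lt_mul_iff w k).2 h)]

theorem exists_eq_mul_simpleRefl {w : Equiv.Perm (Fin r)} (hw : w ≠ 1) :
    ∃ (v : Equiv.Perm (Fin r)) (k : Fin (r - 1)), w = v * simpleRefl k ∧ v (lo k) < v (hi k) ∧
      length v + 1 = length w := by
  obtain ⟨k, hk⟩ := exists_descent w hw
  refine ⟨w * simpleRefl k, k, by rw [mul_assoc, simpleRefl_mul_self, mul_one], ?_, ?_⟩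
  · have hk0 : simpleRefl k (lo k) = hi k := Equiv.swap_apply_left _ _
    have hk1 : simpleRefl k (hi k) = lo k := Equiv.swap_apply_right _ _
    rwa [Equiv.Perm.mul_apply, Equiv.Perm.mul_apply, hk0, hk1]
  · rw [length_eq, length_eq]
    exact invSet_card_of_gt w k hk

theorem adjoin_T_eq_top :
    Algebra.adjoin R (Set.range fun k : Fin (r - 1) =>
      MulOpposite.op (HeckeAlgebra.T (R := R) q (simpleRefl k))) = ⊤ := by
  set S := Algebra.adjoin R (Set.range fun k : Fin (r - 1) =>
    MulOpposite.op (HeckeAlgebra.T (R := R) q (simpleRefl k)))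
  have key : ∀ n : ℕ, ∀ w : Equiv.Perm (Fin r), length w = n →
      MulOpposite.op (HeckeAlgebra.T (R := R) q w) ∈ S := by
    intro n
    induction n using Nat.strong_induction_on with
    | _ n ih =>
      intro w hn
      by_cases hw : w = 1
      · rw [hw, HeckeAlgebra.T_one]; exact S.one_mem
      · obtain ⟨v, k, rfl, h, hl⟩ := exists_eq_mul_simpleRefl hw
        rw [T_mul_simpleRefl q h, MulOpposite.op_mul]
        exact S.mul_mem (Algebra.subset_adjoin ⟨k, rfl⟩) (ih _ (by omega) v rfl)
  rw [eq_top_iff]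
  intro x _
  obtain ⟨h, rfl⟩ := MulOpposite.op_surjective x
  rw [← (HeckeAlgebra.basis q).sum_repr h, Finset.op_sum]
  refine S.sum_mem fun w _ => ?_
  rw [MulOpposite.op_smul]
  exact S.smul_mem (key _ w rfl) _

variable (R r) in
/-- The Hecke algebra as the right regular module. -/
def evalEquiv : HeckeAlgebra R q r ≃ₗ[R] (Equiv.Perm (Fin r) → R) :=
  LinearEquiv.ofBijective (HeckeAlgebra.evalOne q)
    ⟨HeckeAlgebra.evalOne_injective q, HeckeAlgebra.evalOne_surjective q⟩

theorem evalEquiv_T (w : Equiv.Perm (Fin r)) :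
    evalEquiv r R q (HeckeAlgebra.T q w) = Pi.single w 1 :=
  HeckeAlgebra.evalOne_T q w

theorem evalEquiv_mul_T (h : HeckeAlgebra R q r) (k : Fin (r - 1)) :
    evalEquiv r R q (h * HeckeAlgebra.T q (simpleRefl k)) =
      rightOp R q r k (evalEquiv r R q h) := by
  have h1 : rightOp R q r k (Pi.single 1 1) = Pi.single (simpleRefl k) 1 := by
    rw [HeckeAlgebra.rightOp_single, one_mul, if_pos]
    have := (length_lt_mul_iff (1 : Equiv.Perm (Fin r)) k).2 (lo_lt_hi k)
    simpa using this
  have h2 : evalEquiv r R q (h * HeckeAlgebra.T q (simpleRefl k)) =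
    h.1 (evalEquiv r R q (HeckeAlgebra.T q (simpleRefl k))) := rfl
  rw [h2, evalEquiv_T, ← h1, HeckeAlgebra.comm_rightOp]
  rfl

/-- The embedding of the part of the Fock space with `a` letters into the Hecke algebra. -/
def fockToHecke (a : ℕ) : Fock R r →ₗ[R] HeckeAlgebra R q r :=
  (evalEquiv r R q).symm.toLinearMap ∘ₗ fockToFun q a

theorem evalEquiv_fockToHecke (a : ℕ) (g : Fock R r) :
    evalEquiv r R q (fockToHecke q a g) = fockToFun q a g :=
  LinearEquiv.apply_symm_apply _ _

theorem fockToHecke_mul_T (a : ℕ) (g : Fock R r) (k : Fin (r - 1)) :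
    fockToHecke q a g * HeckeAlgebra.T q (simpleRefl k) = fockToHecke q a (fockT q k g) := by
  apply (evalEquiv r R q).injective
  rw [evalEquiv_mul_T, evalEquiv_fockToHecke, evalEquiv_fockToHecke, rightOp_fockToFun]

/-- Every `colSet a w` has exactly `a` elements, so other values of a Fock vector are not seen. -/
theorem fockToHecke_congr {a : ℕ} (ha : a ≤ r) {g h : Fock R r}
    (hgh : ∀ A, A.card = a → g A = h A) : fockToHecke q a g = fockToHecke q a h := by
  apply (evalEquiv r R q).injective
  rw [evalEquiv_fockToHecke, evalEquiv_fockToHecke]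
  funext w
  rw [fockToFun_apply, fockToFun_apply, hgh _ (card_colSet ha w)]

theorem exists_colSet_eq (A : Finset (Fin r)) : ∃ w, colSet A.card w = A := by
  have hcard : A.card ≤ r := by simpa using Finset.card_le_univ A
  have e : {x // x ∈ A} ≃ {x // x ∈ initialSet r A.card} :=
    Fintype.equivOfCardEq (by simp [card_initialSet hcard])
  refine ⟨e.extendSubtype, ?_⟩
  ext x
  rw [mem_colSet, ← mem_initialSet]
  by_cases hx : x ∈ A
  · simp only [hx, iff_true]
    exact e.extendSubtype_mem x hx
  · simp only [hx, iff_false]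
    exact e.extendSubtype_not_mem x hx

theorem apply_eq_of_fockToHecke_eq {g h : Fock R r} (A : Finset (Fin r))
    (hgh : fockToHecke q A.card g = fockToHecke q A.card h) : g A = h A := by
  obtain ⟨w, hw⟩ := exists_colSet_eq A
  have := congrFun (congrArg (evalEquiv r R q) hgh) w
  rw [evalEquiv_fockToHecke, evalEquiv_fockToHecke, fockToFun_apply, fockToFun_apply, hw] at this
  exact (Units.mul_right_inj _).1 this

/-! ### The generators of the right ideals -/

theorem evenCard_le (l : SuperComposition 1 1 r) : l.1 0 ≤ r := by
  have := l.2
  rw [Fin.sum_univ_two] at this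
  omega

theorem mem_block_zero (l : SuperComposition 1 1 r) (x : Fin r) :
    x ∈ block l 0 ↔ (x : ℕ) < l.1 0 := by
  simp [block, Finset.sum_filter]

theorem mem_block_one (l : SuperComposition 1 1 r) (x : Fin r) :
    x ∈ block l 1 ↔ l.1 0 ≤ (x : ℕ) := by
  have := l.2
  rw [Fin.sum_univ_two] at this
  simp [block, Finset.sum_filter, Fin.sum_univ_two, this]

theorem apply_lt_iff_of_fix_ge {a : ℕ} {w : Equiv.Perm (Fin r)}
    (h : ∀ x : Fin r, a ≤ x → w x = x) (x : Fin r) : (w x : ℕ) < a ↔ (x : ℕ) < a := by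
  constructor <;> intro hx <;> by_contra hc
  · rw [h x (not_lt.1 hc)] at hx; exact hc hx
  · rw [w.injective (h _ (not_lt.1 hc))] at hc; exact hc hx

theorem apply_lt_iff_of_fix_lt {a : ℕ} {w : Equiv.Perm (Fin r)}
    (h : ∀ x : Fin r, (x : ℕ) < a → w x = x) (x : Fin r) : (w x : ℕ) < a ↔ (x : ℕ) < a := by
  constructor <;> intro hx
  · have := w.injective (h _ hx); rwa [this] at hx
  · rwa [h x hx]

theorem mem_evenParabolic (l : SuperComposition 1 1 r) (w : Equiv.Perm (Fin r)) :
    w ∈ evenParabolic l ↔ ∀ x : Fin r, l.1 0 ≤ x → w x = x := by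
  classical
  rw [evenParabolic, Finset.mem_filter, Fin.forall_fin_two, Fin.forall_fin_two]
  simp only [mem_block_zero, mem_block_one, Finset.mem_univ, true_and]
  constructor
  · exact fun h => h.2.2 le_rfl
  · intro h
    refine ⟨⟨fun x hx => (apply_lt_iff_of_fix_ge h x).2 hx, fun x hx => by rwa [h x hx]⟩,
      fun h0 => absurd h0 (by simp), fun _ => h⟩

theorem mem_oddParabolic (l : SuperComposition 1 1 r) (w : Equiv.Perm (Fin r)) :
    w ∈ oddParabolic l ↔ ∀ x : Fin r, (x : ℕ) < l.1 0 → w x = x := by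
  classical
  rw [oddParabolic, Finset.mem_filter, Fin.forall_fin_two, Fin.forall_fin_two]
  simp only [mem_block_zero, mem_block_one, Finset.mem_univ, true_and]
  constructor
  · exact fun h => h.2.1 (by simp)
  · intro h
    refine ⟨⟨fun x hx => by rwa [h x hx], fun x hx => ?_⟩, fun _ => h,
      fun h0 => absurd h0 (by simp)⟩
    have := (apply_lt_iff_of_fix_lt h x).not
    simpa using this.2 (by omega)

/-- Lengths add for a product of the even and the odd parabolic subgroup. Peel off a descent of `v`:
it involves only letters and values that are at least `a`, and `u` fixes these values, so the
corresponding ascent of the shorter factor persists after multiplication by `u`. -/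
theorem T_mul_T_of_fix {a : ℕ} {u : Equiv.Perm (Fin r)} (hu : ∀ x : Fin r, a ≤ x → u x = x) :
    ∀ n : ℕ, ∀ v : Equiv.Perm (Fin r), length v = n → (∀ x : Fin r, (x : ℕ) < a → v x = x) →
      HeckeAlgebra.T (R := R) q u * HeckeAlgebra.T q v = HeckeAlgebra.T q (u * v) := by
  intro n
  induction n using Nat.strong_induction_on with
  | _ n ih =>
    intro v hn hv
    by_cases hv1 : v = 1
    · rw [hv1, HeckeAlgebra.T_one, mul_one, mul_one]
    · obtain ⟨v, k, rfl, h, hl⟩ := exists_eq_mul_simpleRefl hv1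
      have hk0 : simpleRefl k (lo k) = hi k := Equiv.swap_apply_left _ _
      have hk1 : simpleRefl k (hi k) = lo k := Equiv.swap_apply_right _ _
      have hge := apply_lt_iff_of_fix_lt hv
      have hlo := hge (lo k)
      have hhi := hge (hi k)
      rw [Equiv.Perm.mul_apply, hk0] at hlo
      rw [Equiv.Perm.mul_apply, hk1] at hhi
      -- If `k < a`, the product `v * simpleRefl k` fixes `k`, hence also `k + 1` because the value
      -- there is smaller than `a`; but then it has no descent at `k`.
      have hka : a ≤ ((lo k : Fin r) : ℕ) := by
        by_contra hc
        have h1 := hv (lo k) (by omega)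
        have h2 : (v (lo k) : ℕ) < a := by rw [Fin.lt_def] at h; omega
        have h3 := hv (hi k) (hhi.1 h2)
        rw [Equiv.Perm.mul_apply, hk0] at h1
        rw [Equiv.Perm.mul_apply, hk1] at h3
        rw [h1, h3] at h
        exact lt_asymm h (lo_lt_hi k)
      have hkh : a ≤ ((hi k : Fin r) : ℕ) := hka.trans (lo_lt_hi k).le
      have hv' : ∀ x : Fin r, (x : ℕ) < a → v x = x := by
        intro x hx
        have := hv x hx
        rwa [Equiv.Perm.mul_apply, simpleRefl, Equiv.swap_apply_of_ne_of_ne] at this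
        · rintro rfl; omega
        · rintro rfl; omega
      rw [T_mul_simpleRefl q h, ← mul_assoc, ih _ (by omega) v rfl hv', ← mul_assoc,
        ← T_mul_simpleRefl]
      rw [Equiv.Perm.mul_apply, Equiv.Perm.mul_apply, hu _ (by omega), hu _ (by omega)]
      exact h

/-- All inversions of `v` lie among values at least `a`, where `u` is the identity; inversions
created by `u` have values below `a`. -/
theorem oddInv_mul {a : ℕ} {u v : Equiv.Perm (Fin r)} (hu : ∀ x : Fin r, a ≤ x → u x = x)
    (hv : ∀ x : Fin r, (x : ℕ) < a → v x = x) : oddInv a (u * v) = length v := by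
  rw [length_eq, oddInv]
  congr 1
  ext ⟨x, y⟩
  have hu' := apply_lt_iff_of_fix_ge hu
  have hv' := apply_lt_iff_of_fix_lt hv
  rw [Finset.mem_filter, mem_invSet, mem_invSet, Equiv.Perm.mul_apply, Equiv.Perm.mul_apply]
  have h1 := hu' (v x)
  have h2 := hu' (v y)
  have h3 := hv' x
  have h4 := hv' y
  constructor
  · rintro ⟨⟨hxy, h⟩, hy⟩
    refine ⟨hxy, ?_⟩
    have hy' : a ≤ (v y : ℕ) := by omega
    rw [Fin.lt_def] at h
    have hx' : a ≤ (v x : ℕ) := by omega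
    rwa [hu _ hy', hu _ hx', ← Fin.lt_def] at h
  · rintro ⟨hxy, h⟩
    have hy' : a ≤ (v y : ℕ) := by
      by_contra hc
      have hy := hv y (h4.1 (by omega))
      have hx : (x : ℕ) < a := by rw [hy] at hc; rw [Fin.lt_def] at hxy; omega
      rw [hy, hv x hx] at h
      exact lt_asymm h hxy
    have hx' : a ≤ (v x : ℕ) := by rw [Fin.lt_def] at h; omega
    rw [hu _ hy', hu _ hx']
    exact ⟨⟨hxy, h⟩, by simpa using hy'⟩

theorem exists_mul_of_preserves {a : ℕ} {w : Equiv.Perm (Fin r)}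
    (h : ∀ x, (w x : ℕ) < a ↔ (x : ℕ) < a) : ∃ u v : Equiv.Perm (Fin r),
      (∀ x : Fin r, a ≤ x → u x = x) ∧ (∀ x : Fin r, (x : ℕ) < a → v x = x) ∧ u * v = w := by
  classical
  set v := Equiv.Perm.ofSubtype (w.subtypePerm (p := fun x : Fin r => ¬ (x : ℕ) < a)
    fun x => (h x).not) with hv
  have hv1 : ∀ x : Fin r, (x : ℕ) < a → v x = x := fun x hx =>
    Equiv.Perm.ofSubtype_apply_of_not_mem _ (by simpa using hx)
  have hv2 : ∀ x : Fin r, ¬ (x : ℕ) < a → v x = w x := fun x hx =>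
    Equiv.Perm.ofSubtype_apply_of_mem (p := fun x : Fin r => ¬ (x : ℕ) < a) _ hx
  refine ⟨w * v⁻¹, v, fun x hx => ?_, hv1, by group⟩
  obtain ⟨y, rfl⟩ := v.surjective x
  rw [Equiv.Perm.mul_apply, Equiv.Perm.inv_def, Equiv.symm_apply_apply]
  have := apply_lt_iff_of_fix_lt hv1 y
  exact (hv2 y (by omega)).symm

theorem eq_of_mul_eq_mul_of_fix {a : ℕ} {u v u' v' : Equiv.Perm (Fin r)}
    (hu : ∀ x : Fin r, a ≤ x → u x = x) (hv : ∀ x : Fin r, (x : ℕ) < a → v x = x)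
    (hu' : ∀ x : Fin r, a ≤ x → u' x = x) (hv' : ∀ x : Fin r, (x : ℕ) < a → v' x = x)
    (h : u * v = u' * v') : u = u' ∧ v = v' := by
  have key : v = v' := by
    ext1 x
    by_cases hx : (x : ℕ) < a
    · rw [hv x hx, hv' x hx]
    · have h1 := apply_lt_iff_of_fix_lt hv x
      have h2 := apply_lt_iff_of_fix_lt hv' x
      have := congrArg (fun e : Equiv.Perm (Fin r) => e x) h
      simpa only [Equiv.Perm.mul_apply, hu (v x) (by omega), hu' (v' x) (by omega)] using this
  subst key
  exact ⟨mul_right_cancel h, rfl⟩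

theorem colSet_eq_initialSet_iff {a : ℕ} {w : Equiv.Perm (Fin r)} :
    colSet a w = initialSet r a ↔ ∀ x, (w x : ℕ) < a ↔ (x : ℕ) < a := by
  simp only [Finset.ext_iff, mem_colSet, mem_initialSet]

/-- The products `u * v` of the two parabolic subgroups are, without repetition, the permutations
that preserve the first `a` letters, that is those with `colSet a w` initial. Their coefficient
`(-q)^{-ℓ(v)}` is the weight given by `oddInv`. -/
theorem xElt_mul_yElt (l : SuperComposition 1 1 r) :
    xElt R q l * yElt R q l = fockToHecke q (l.1 0) (vac r R (l.1 0)) := by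
  set a := l.1 0 with ha
  apply (evalEquiv r R q).injective
  rw [evalEquiv_fockToHecke, xElt, yElt, Finset.sum_mul_sum]
  have h1 : ∀ u ∈ evenParabolic l, ∀ v ∈ oddParabolic l, HeckeAlgebra.T q u *
      ((((-q)⁻¹ ^ length v : Rˣ) : R)) • HeckeAlgebra.T q v =
      ((((-q)⁻¹ ^ length v : Rˣ) : R)) • HeckeAlgebra.T (R := R) q (u * v) := by
    intro u hu v hv
    rw [mul_smul_comm, T_mul_T_of_fix q ((mem_evenParabolic l u).1 hu) _ v rfl
      ((mem_oddParabolic l v).1 hv)]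
  rw [Finset.sum_congr rfl fun u hu => Finset.sum_congr rfl fun v hv => h1 u hu v hv,
    ← Finset.sum_product', map_sum]
  funext w
  simp only [map_smul, evalEquiv_T, Finset.sum_apply, Pi.smul_apply, smul_eq_mul]
  rw [fockToFun_apply]
  by_cases hw : colSet a w = initialSet r a
  · obtain ⟨u, v, hu, hv, rfl⟩ := exists_mul_of_preserves (colSet_eq_initialSet_iff.1 hw)
    rw [hw, vac_initialSet, Finset.sum_eq_single (u, v), Pi.single_eq_same, oddInv_mul hu hv]
    · rintro ⟨u', v'⟩ hm hne
      rw [Finset.mem_product, mem_evenParabolic, mem_oddParabolic] at hm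
      rw [Pi.single_eq_of_ne, mul_zero]
      intro h
      obtain ⟨rfl, rfl⟩ := eq_of_mul_eq_mul_of_fix hu hv hm.1 hm.2 h
      exact hne rfl
    · intro hm
      refine absurd (Finset.mem_product.2 ⟨?_, ?_⟩) hm
      · exact (mem_evenParabolic l u).2 hu
      · exact (mem_oddParabolic l v).2 hv
  · rw [vac_eq_zero hw, mul_zero]
    refine Finset.sum_eq_zero fun p hp => ?_
    rw [Finset.mem_product, mem_evenParabolic, mem_oddParabolic] at hp
    rw [Pi.single_eq_of_ne, mul_zero]
    rintro rfl
    refine hw (colSet_eq_initialSet_iff.2 fun x => ?_)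
    rw [Equiv.Perm.mul_apply, apply_lt_iff_of_fix_ge hp.1, apply_lt_iff_of_fix_lt hp.2]

/-- The image is stable under the generators `T_s` and contains the generator of the ideal, which
gives one inclusion. The other one is the cyclicity of the part with `a` letters. -/
theorem mem_permModule_iff (l : SuperComposition 1 1 r) (h : HeckeAlgebra R q r) :
    h ∈ permModule R q l ↔ ∃ g, fockToHecke q (l.1 0) g = h := by
  set a := l.1 0 with ha
  constructor
  · intro hh
    obtain ⟨s, rfl⟩ := Submodule.mem_span_singleton.1 hh
    rw [xElt_mul_yElt]
    have hs : s ∈ Algebra.adjoin R (Set.range fun k : Fin (r - 1) =>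
        MulOpposite.op (HeckeAlgebra.T (R := R) q (simpleRefl k))) := by
      rw [adjoin_T_eq_top]; trivial
    clear hh
    generalize vac r R (l.1 0) = g
    induction hs using Algebra.adjoin_induction generalizing g with
    | mem s hs =>
      obtain ⟨k, rfl⟩ := hs
      exact ⟨fockT q k g, (fockToHecke_mul_T q a g k).symm⟩
    | algebraMap c => exact ⟨c • g, by rw [map_smul, algebraMap_smul]⟩
    | add s t _ _ hs ht =>
      obtain ⟨g1, h1⟩ := hs g
      obtain ⟨g2, h2⟩ := ht g
      exact ⟨g1 + g2, by rw [map_add, h1, h2, add_smul]⟩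
    | mul s t _ _ hs ht =>
      obtain ⟨g1, h1⟩ := ht g
      obtain ⟨g2, h2⟩ := hs g1
      exact ⟨g2, by rw [h2, mul_smul, ← ha, h1]⟩
  · rintro ⟨g, rfl⟩
    -- Only the component of weight `a` is generated by `vac a`, so the other components, which do
    -- not affect the image, are dropped first.
    rw [fockToHecke_congr q (evenCard_le l) (h := weightProj r R a g)
      fun A hA => by rw [weightProj_apply, if_pos hA]]
    refine mem_of_vac_mem q (Submodule.comap (fockToHecke q a)
      ((permModule R q l).restrictScalars R)) (fun k g hg => ?_) a ?_ _ fun A hA => ?_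
    · rw [Submodule.mem_comap, Submodule.restrictScalars_mem] at hg ⊢
      rw [← fockToHecke_mul_T]
      exact (permModule R q l).smul_mem (MulOpposite.op (HeckeAlgebra.T q (simpleRefl k))) hg
    · rw [Submodule.mem_comap, Submodule.restrictScalars_mem, ← xElt_mul_yElt]
      exact Submodule.mem_span_singleton_self _
    · rw [weightProj_apply, if_neg hA]

/-- The composition with even part `a`. -/
def compositionOf (a : ℕ) (h : a ≤ r) : SuperComposition 1 1 r :=
  ⟨![a, r - a], by rw [Fin.sum_univ_two]; simp; omega⟩

theorem compositionOf_evenCard (l : SuperComposition 1 1 r) :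
    compositionOf (l.1 0) (evenCard_le l) = l := by
  have := l.2
  rw [Fin.sum_univ_two] at this
  apply Subtype.ext
  funext i
  refine Fin.cases rfl (fun j => ?_) i
  obtain rfl : j = 0 := Subsingleton.elim _ _
  change r - l.1 0 = l.1 1
  omega

/-- The embedding of the Fock space into the tensor space. -/
def fockToTensor : Fock R r →ₗ[R] TensorSpace 1 1 r R q :=
  LinearMap.pi fun l => (fockToHecke q (l.1 0)).codRestrict
    ((permModule R q l).restrictScalars R) fun g => (mem_permModule_iff q l _).2 ⟨g, rfl⟩

theorem fockToTensor_apply (g : Fock R r) (l : SuperComposition 1 1 r) :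
    (fockToTensor q g l : HeckeAlgebra R q r) = fockToHecke q (l.1 0) g := rfl

theorem fockToTensor_bijective : Function.Bijective (fockToTensor (R := R) (r := r) q) := by
  constructor
  · intro g h hgh
    funext A
    apply apply_eq_of_fockToHecke_eq q
    have hA : A.card ≤ r := by simpa using Finset.card_le_univ A
    exact congrArg Subtype.val (congrFun hgh (compositionOf A.card hA))
  · intro m
    choose G hG using fun l => (mem_permModule_iff q l _).1 (m l).2
    -- The value at `A` is taken from the summand whose even part has size `A.card`; the other
    -- branch never occurs.
    refine ⟨fun A => if hA : A.card ≤ r then G (compositionOf A.card hA) A else 0, ?_⟩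
    funext l
    apply Subtype.ext
    rw [fockToTensor_apply, ← hG]
    refine fockToHecke_congr q (evenCard_le l) fun A hA => ?_
    have hA' : A.card ≤ r := by simpa using Finset.card_le_univ A
    have : compositionOf A.card hA' = l := by
      conv_rhs => rw [← compositionOf_evenCard l]
      congr
    rw [dif_pos hA', this]

variable (R r) in
/-- The endomorphism algebra of the tensor space is the commutant of the action of the Hecke algebra
on the Fock space. -/
def schurEndEquiv : SchurEnd 1 1 r R q ≃ₐ[R] fockCommutant q r :=
  endEquivCentralizer (adjoin_T_eq_top q)
    (LinearEquiv.ofBijective (fockToTensor q) (fockToTensor_bijective q)) (fockT q) fun k g => by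
      funext l
      exact Subtype.ext (fockToHecke_mul_T q (l.1 0) g k).symm

end

universe v

/-! ### Simple modules -/

section SimpleModules

variable {A : Type*} [Ring A]

/-- The inclusion of annihilators makes `x • m ↦ x • n` well defined, and a nonzero map between
simple modules is an isomorphism. -/
theorem nonempty_equiv_of_annihilator_le {M N : Type*} [AddCommGroup M] [Module A M]
    [AddCommGroup N] [Module A N] [IsSimpleModule A M] [IsSimpleModule A N] {m : M} {n : N}
    (hm : m ≠ 0) (hn : n ≠ 0) (h : ∀ x : A, x • m = 0 → x • n = 0) : Nonempty (M ≃ₗ[A] N) := by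
  let e := LinearMap.quotKerEquivOfSurjective _ (IsSimpleModule.toSpanSingleton_surjective A hm)
  let f : M →ₗ[A] N := (Submodule.liftQ (LinearMap.ker (LinearMap.toSpanSingleton A M m))
    (LinearMap.toSpanSingleton A N n) fun x hx => by simpa using h x (by simpa using hx)) ∘ₗ
      e.symm.toLinearMap
  have hf : f m = n := by
    have : e.symm m = Submodule.Quotient.mk 1 := by
      rw [LinearEquiv.symm_apply_eq]
      simp [e, LinearMap.quotKerEquivOfSurjective]
    simp [f, this]
  refine ⟨LinearEquiv.ofBijective f ((LinearMap.bijective_or_eq_zero f).resolve_right fun h0 => ?_)⟩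
  rw [h0] at hf
  exact hn hf.symm

/-- A maximal left ideal containing the left annihilator of `f` contains `1 - f`, hence not `f`; so
`f` does not kill the class of `1` in the quotient. -/
theorem exists_simple_of_idempotent {A : Type v} [Ring A] {f : A} (hf : f * f = f) (h0 : f ≠ 0) :
    ∃ (L : Type v) (_ : AddCommGroup L) (_ : Module A L), IsSimpleModule A L ∧
      ∃ l : L, f • l ≠ 0 := by
  have hne : LinearMap.ker (LinearMap.toSpanSingleton A A f) ≠ ⊤ := by
    intro h
    have : (1 : A) ∈ LinearMap.ker (LinearMap.toSpanSingleton A A f) := by rw [h]; trivial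
    exact h0 (by simpa using this)
  obtain ⟨J, hJ, hle⟩ := Ideal.exists_le_maximal _ hne
  refine ⟨A ⧸ J, inferInstance, inferInstance, isSimpleModule_iff_isCoatom.2 hJ.out,
    Submodule.Quotient.mk 1, ?_⟩
  rw [← Submodule.Quotient.mk_smul, smul_eq_mul, mul_one, ne_eq, Submodule.Quotient.mk_eq_zero]
  intro hfJ
  refine hJ.ne_top ((Ideal.eq_top_iff_one _).2 ?_)
  have h1 : 1 - f ∈ J := hle (by simp [sub_mul, hf])
  simpa using J.add_mem h1 hfJ

end SimpleModules

/-! ### ### Transport, base change and weights -/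

namespace IsRankOneSchur

section Basic

variable {R A B : Type*} [CommRing R] [Ring A] [Algebra R A] [Ring B] [Algebra R B] {r : ℕ} {c : R}
  {e : ℕ → A} {E F : A}

theorem map (h : IsRankOneSchur r c e E F) (φ : A ≃ₐ[R] B) :
    IsRankOneSchur r c (fun a => φ (e a)) (φ E) (φ F) where
  e_mul_e a b := by rw [← map_mul, h.e_mul_e]; split_ifs <;> simp
  sum_e := by rw [← map_sum, h.sum_e, map_one]
  e_mul_E a := by rw [← map_mul, h.e_mul_E, map_mul]
  e_mul_F a := by rw [← map_mul, h.e_mul_F, map_mul]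
  E_mul_E := by rw [← map_mul, h.E_mul_E, map_zero]
  F_mul_F := by rw [← map_mul, h.F_mul_F, map_zero]
  anticomm := by rw [← map_mul, ← map_mul, ← map_add, h.anticomm, AlgEquiv.commutes]
  exists_eq_sum x := by
    obtain ⟨α, β, γ, δ, hx⟩ := h.exists_eq_sum (φ.symm x)
    refine ⟨α, β, γ, δ, ?_⟩
    rw [AlgEquiv.symm_apply_eq] at hx
    simpa only [map_sum, map_add, map_smul, map_mul] using hx
  exists_coord_e a ha := by
    obtain ⟨f, hf⟩ := h.exists_coord_e a ha
    exact ⟨f ∘ₗ φ.symm.toLinearMap, by simpa using hf⟩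
  exists_coord_F a ha := by
    obtain ⟨f, hf⟩ := h.exists_coord_F a ha
    exact ⟨f ∘ₗ φ.symm.toLinearMap, by simpa using hf⟩

/-- Relations and spanning sets pass to any base change, but nonvanishing need not. The coordinate
functionals do pass, and they are what guarantees nonzero elements after specialisation without
proving that the algebra is free. -/
theorem baseChange (h : IsRankOneSchur r c e E F) (K : Type*) [CommRing K] [Algebra R K] :
    IsRankOneSchur (A := K ⊗[R] A) r (algebraMap R K c) (fun a => 1 ⊗ₜ e a) (1 ⊗ₜ E)
      (1 ⊗ₜ F) := by
  have hc (f : A →ₗ[R] R) (x : A) (hf : f x = 1) : ∃ g : K ⊗[R] A →ₗ[K] K, g (1 ⊗ₜ x) = 1 :=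
    ⟨(TensorProduct.AlgebraTensorModule.rid R K K).toLinearMap ∘ₗ f.baseChange K, by simp [hf]⟩
  refine ⟨fun a b => ?_, ?_, fun a => ?_, fun a => ?_, ?_, ?_, ?_, fun x => ?_, fun a ha => ?_,
    fun a ha => ?_⟩
  · rw [Algebra.TensorProduct.tmul_mul_tmul, h.e_mul_e, mul_one]; split_ifs <;> simp
  · rw [← TensorProduct.tmul_sum, h.sum_e]; rfl
  · simp only [Algebra.TensorProduct.tmul_mul_tmul, h.e_mul_E]
  · simp only [Algebra.TensorProduct.tmul_mul_tmul, h.e_mul_F]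
  · rw [Algebra.TensorProduct.tmul_mul_tmul, h.E_mul_E, TensorProduct.tmul_zero]
  · rw [Algebra.TensorProduct.tmul_mul_tmul, h.F_mul_F, TensorProduct.tmul_zero]
  · rw [Algebra.TensorProduct.tmul_mul_tmul, Algebra.TensorProduct.tmul_mul_tmul,
      ← TensorProduct.tmul_add, h.anticomm, Algebra.algebraMap_eq_smul_one,
      ← TensorProduct.smul_tmul, mul_one, Algebra.TensorProduct.algebraMap_apply,
      Algebra.algebraMap_self, RingHom.id_apply, Algebra.algebraMap_eq_smul_one]
  · simp only [Algebra.TensorProduct.tmul_mul_tmul, mul_one]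
    induction x with
    | zero => exact ⟨0, 0, 0, 0, by simp⟩
    | tmul k x =>
      obtain ⟨α, β, γ, δ, hx⟩ := h.exists_eq_sum x
      have hs (s : R) (y : A) : k ⊗ₜ[R] (s • y) = (algebraMap R K s * k) • ((1 : K) ⊗ₜ[R] y) := by
        rw [TensorProduct.smul_tmul', smul_eq_mul, mul_one, ← Algebra.smul_def,
          TensorProduct.smul_tmul]
      refine ⟨fun a => algebraMap R K (α a) * k, fun a => algebraMap R K (β a) * k,
        fun a => algebraMap R K (γ a) * k, fun a => algebraMap R K (δ a) * k, ?_⟩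
      rw [hx, TensorProduct.tmul_sum]
      simp only [TensorProduct.tmul_add, hs]
    | add x y hx hy =>
      obtain ⟨α, β, γ, δ, hx⟩ := hx
      obtain ⟨α', β', γ', δ', hy⟩ := hy
      refine ⟨α + α', β + β', γ + γ', δ + δ', ?_⟩
      conv_lhs => rw [hx, hy]
      rw [← Finset.sum_add_distrib]
      refine Finset.sum_congr rfl fun a _ => ?_
      simp only [Pi.add_apply, add_smul]
      abel
  · obtain ⟨f, hf⟩ := h.exists_coord_e a ha
    exact hc f _ hf
  · obtain ⟨f, hf⟩ := h.exists_coord_F a ha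
    rw [Algebra.TensorProduct.tmul_mul_tmul, mul_one]
    exact hc f _ hf

theorem e_eq_zero (h : IsRankOneSchur r c e E F) {a : ℕ} (ha : r < a) : e a = 0 := by
  rw [← mul_one (e a), ← h.sum_e, Finset.mul_sum]
  refine Finset.sum_eq_zero fun b hb => ?_
  rw [Finset.mem_range] at hb
  rw [h.e_mul_e, if_neg (by omega)]

theorem F_mul_e_zero (h : IsRankOneSchur r c e E F) : F * e 0 = 0 := by
  rw [← one_mul (F * e 0), ← h.sum_e, Finset.sum_mul]
  refine Finset.sum_eq_zero fun b _ => ?_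
  rw [← mul_assoc, h.e_mul_F, mul_assoc, h.e_mul_e, if_neg (by omega), mul_zero]

/-- In positive weight this is two shifts that cancel. In weight `0` the relations say nothing about
`e 0 * E`, so both sides are shown to vanish using `F * e 0 = 0` and orthogonality. -/
theorem E_F_mul_e (h : IsRankOneSchur r c e E F) (a : ℕ) : E * F * e a = e a * (E * F) := by
  cases a with
  | zero =>
    rw [mul_assoc, h.F_mul_e_zero, mul_zero, ← mul_one (e 0 * (E * F)), ← h.sum_e, Finset.mul_sum]
    refine (Finset.sum_eq_zero fun b _ => ?_).symm
    cases b with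
    | zero => rw [mul_assoc, mul_assoc, h.F_mul_e_zero, mul_zero, mul_zero]
    | succ b =>
      rw [mul_assoc, mul_assoc, ← h.e_mul_F, ← mul_assoc E, ← h.e_mul_E, ← mul_assoc, ← mul_assoc,
        h.e_mul_e, if_neg (by omega), zero_mul, zero_mul]
  | succ a => rw [← mul_assoc, h.e_mul_E, mul_assoc, mul_assoc, h.e_mul_F]

theorem sum_e_smul (h : IsRankOneSchur r c e E F) {M : Type*} [AddCommGroup M] [Module A M]
    (m : M) : ∑ a ∈ Finset.range (r + 1), e a • m = m := by
  rw [← Finset.sum_smul, h.sum_e, one_smul]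

end Basic

end IsRankOneSchur

/-- A nonzero vector of weight `a` that is killed by `E`. -/
structure IsHighestVector {A : Type*} [Ring A] (e : ℕ → A) (E : A) {M : Type*} [AddCommGroup M]
    [Module A M] (a : ℕ) (m : M) : Prop where
  ne_zero : m ≠ 0
  e_smul : e a • m = m
  E_smul : E • m = 0

/-! ### ### Modules generated by a highest vector -/

namespace IsHighestVector

variable {K A : Type*} [Field K] [Ring A] [Algebra K A] {r : ℕ} {c : K} {e : ℕ → A} {E F : A}
  {M N : Type*} [AddCommGroup M] [Module A M] [AddCommGroup N] [Module A N] {a b : ℕ} {m : M}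
  {n : N}

theorem e_smul_eq (hm : IsHighestVector e E a m) (h : IsRankOneSchur r c e E F) (b : ℕ) :
    e b • m = if b = a then m else 0 := by
  conv_lhs => rw [← hm.e_smul, ← mul_smul, h.e_mul_e]
  split_ifs with hb
  · rw [hb, hm.e_smul]
  · rw [zero_smul]

theorem weight_le (hm : IsHighestVector e E a m) (h : IsRankOneSchur r c e E F) : a ≤ r := by
  by_contra ha
  apply hm.ne_zero
  rw [← hm.e_smul, h.e_eq_zero (by omega), zero_smul]

theorem of_E_F (h : IsRankOneSchur r c e E F) (a : ℕ) {m : M} (hm : (E * F * e a) • m ≠ 0) :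
    IsHighestVector e E a ((E * F * e a) • m) where
  ne_zero := hm
  e_smul := by
    rw [← mul_smul, h.E_F_mul_e, ← mul_assoc, h.e_mul_e, if_pos rfl]
  E_smul := by
    rw [← mul_smul, ← mul_assoc, ← mul_assoc, h.E_mul_E, zero_mul, zero_mul, zero_smul]

variable [Module K M] [IsScalarTower K A M] [Module K N] [IsScalarTower K A N]

theorem E_F_smul (hm : IsHighestVector e E a m) (h : IsRankOneSchur r c e E F) :
    E • F • m = c • m := by
  rw [← algebraMap_smul A c m, ← h.anticomm, add_smul, mul_smul, mul_smul, hm.E_smul, smul_zero,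
    add_zero]

/-- Only the terms of weight `a` act, `E` kills `m`, and `E F m = c m`. When `c ≠ 0` the vectors `m`
and `F • m` are independent, so this formula shows that the annihilator of `m` depends only on `a`.
-/
theorem smul_eq (hm : IsHighestVector e E a m) (h : IsRankOneSchur r c e E F) (α β γ δ : ℕ → K) :
    (∑ b ∈ Finset.range (r + 1), (α b • e b + β b • (E * e b) + γ b • (F * e b) +
      δ b • (E * F * e b))) • m = (α a + c * δ a) • m + γ a • F • m := by
  rw [Finset.sum_smul, Finset.sum_eq_single a]
  · simp only [add_smul, smul_assoc, mul_smul, hm.e_smul, hm.E_smul, hm.E_F_smul h, smul_zero]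
    rw [smul_comm c (δ a)]
    abel
  · intro b _ hb
    simp only [add_smul, smul_assoc, mul_smul, hm.e_smul_eq h, if_neg hb, smul_zero, add_zero]
  · intro ha
    exact absurd (Finset.mem_range.2 (Nat.lt_succ_of_le (hm.weight_le h))) ha

theorem exists_smul_eq (hm : IsHighestVector e E a m) (h : IsRankOneSchur r c e E F) (x : A) :
    ∃ α γ : K, x • m = α • m + γ • F • m := by
  obtain ⟨α, β, γ, δ, rfl⟩ := h.exists_eq_sum x
  exact ⟨_, _, hm.smul_eq h α β γ δ⟩

theorem eq_zero_of_combination (hm : IsHighestVector e E a m) (h : IsRankOneSchur r c e E F)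
    (hc : c ≠ 0) {α γ : K} (h0 : α • m + γ • F • m = 0) : α = 0 ∧ γ = 0 := by
  have h1 := congrArg (E • ·) h0
  simp only [smul_add, smul_zero] at h1
  rw [smul_comm E α, smul_comm E γ, hm.E_smul, smul_zero, zero_add, hm.E_F_smul h, smul_smul,
    smul_eq_zero] at h1
  have hγ : γ = 0 := by simpa [hc, hm.ne_zero] using h1
  rw [hγ, zero_smul, add_zero, smul_eq_zero] at h0
  exact ⟨h0.resolve_right hm.ne_zero, hγ⟩

theorem weight_pos (hm : IsHighestVector e E a m) (h : IsRankOneSchur r c e E F) (hc : c ≠ 0) :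
    0 < a := by
  rcases Nat.eq_zero_or_pos a with rfl | ha
  · have h0 : F • m = 0 := by rw [← hm.e_smul, ← mul_smul, h.F_mul_e_zero, zero_smul]
    have := hm.E_F_smul h
    rw [h0, smul_zero, eq_comm, smul_eq_zero] at this
    simp [hc, hm.ne_zero] at this
  · exact ha

theorem nonempty_equiv [IsSimpleModule A M] [IsSimpleModule A N] (hm : IsHighestVector e E a m)
    (hn : IsHighestVector e E a n) (h : IsRankOneSchur r c e E F) (hc : c ≠ 0) :
    Nonempty (M ≃ₗ[A] N) := by
  refine nonempty_equiv_of_annihilator_le hm.ne_zero hn.ne_zero fun x hx => ?_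
  obtain ⟨α, β, γ, δ, rfl⟩ := h.exists_eq_sum x
  rw [hm.smul_eq h] at hx
  obtain ⟨h1, h2⟩ := hm.eq_zero_of_combination h hc hx
  rw [hn.smul_eq h, h1, h2, zero_smul, zero_smul, add_zero]

/-- When `c ≠ 0`, a combination of `m` and `F • m` killed by `E` is a multiple of `m`, so a simple
module determines its highest weight. -/
theorem weight_eq [IsSimpleModule A M] {m' : M} (hm : IsHighestVector e E a m)
    (hm' : IsHighestVector e E b m') (h : IsRankOneSchur r c e E F) (hc : c ≠ 0) : a = b := by
  obtain ⟨x, hx⟩ := IsSimpleModule.toSpanSingleton_surjective A hm.ne_zero m'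
  rw [LinearMap.toSpanSingleton_apply] at hx
  obtain ⟨α, γ, hαγ⟩ := hm.exists_smul_eq h x
  rw [hx] at hαγ
  have h1 := hm'.E_smul
  rw [hαγ, smul_add, smul_comm E α, smul_comm E γ, hm.E_smul, smul_zero, zero_add,
    hm.E_F_smul h, smul_smul, smul_eq_zero] at h1
  have hγ : γ = 0 := by simpa [hc, hm.ne_zero] using h1
  rw [hγ, zero_smul, add_zero] at hαγ
  by_contra hab
  apply hm'.ne_zero
  rw [← hm'.e_smul, hαγ, smul_comm (e b), hm.e_smul_eq h, if_neg (Ne.symm hab), smul_zero]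

theorem finrank_eq_two [IsSimpleModule A M] (hm : IsHighestVector e E a m)
    (h : IsRankOneSchur r c e E F) (hc : c ≠ 0) : Module.finrank K M = 2 := by
  have hli : LinearIndependent K ![m, F • m] :=
    LinearIndependent.pair_iff.2 fun s t hst => hm.eq_zero_of_combination h hc hst
  have hsp : ⊤ ≤ Submodule.span K (Set.range ![m, F • m]) := by
    intro y _
    obtain ⟨x, rfl⟩ := IsSimpleModule.toSpanSingleton_surjective A hm.ne_zero y
    obtain ⟨α, γ, hx⟩ := hm.exists_smul_eq h x
    rw [LinearMap.toSpanSingleton_apply, hx, Matrix.range_cons_cons_empty]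
    exact Submodule.mem_span_pair.2 ⟨α, γ, rfl⟩
  rw [Module.finrank_eq_card_basis (Module.Basis.mk hli hsp), Fintype.card_fin]

/-- Any nonzero `α • m + γ • F • m` leads back to `m`: by a scalar if `γ = 0`, and otherwise by `E`,
which sends it to `(γ * c) • m`. -/
theorem isSimpleModule_span (hm : IsHighestVector e E a m) (h : IsRankOneSchur r c e E F)
    (hc : c ≠ 0) : IsSimpleModule A (Submodule.span A {m}) := by
  rw [isSimpleModule_iff_toSpanSingleton_surjective]
  refine ⟨⟨⟨⟨m, Submodule.mem_span_singleton_self m⟩, 0, fun h0 => hm.ne_zero ?_⟩⟩, ?_⟩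
  · exact congrArg Subtype.val h0
  rintro ⟨y, hy⟩ hy0 ⟨z, hz⟩
  obtain ⟨x, rfl⟩ := Submodule.mem_span_singleton.1 hy
  obtain ⟨w, rfl⟩ := Submodule.mem_span_singleton.1 hz
  have hx0 : x • m ≠ 0 := fun h0 => hy0 (Subtype.ext h0)
  suffices ∃ u : A, u • x • m = m by
    obtain ⟨u, hu⟩ := this
    exact ⟨w * u, Subtype.ext (by simp [mul_smul, hu])⟩
  obtain ⟨α, γ, hx⟩ := hm.exists_smul_eq h x
  rw [hx] at hx0 ⊢
  by_cases hγ : γ = 0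
  · rw [hγ, zero_smul, add_zero] at hx0 ⊢
    have hα : α ≠ 0 := fun h0 => hx0 (by rw [h0, zero_smul])
    exact ⟨algebraMap K A α⁻¹, by rw [algebraMap_smul, smul_smul, inv_mul_cancel₀ hα, one_smul]⟩
  · refine ⟨algebraMap K A (γ * c)⁻¹ * E, ?_⟩
    rw [mul_smul, smul_add, smul_comm E α, smul_comm E γ, hm.E_smul, smul_zero, zero_add,
      hm.E_F_smul h, algebraMap_smul, smul_smul, smul_smul, mul_assoc,
      inv_mul_cancel₀ (mul_ne_zero hγ hc), one_smul]

end IsHighestVector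

namespace IsRankOneSchur

/-! ### ### The semisimple case: nonzero central element -/

section Semisimple

variable {K : Type*} {A : Type u} [Field K] [Ring A] [Algebra K A] {r : ℕ} {c : K} {e : ℕ → A}
  {E F : A}

theorem smul_eq_sub (h : IsRankOneSchur r c e E F) {M : Type*} [AddCommGroup M] [Module A M]
    [Module K M] [IsScalarTower K A M] (m : M) : c • m = E • F • m + F • E • m := by
  rw [← mul_smul, ← mul_smul, ← add_smul, h.anticomm, algebraMap_smul]

theorem E_F_E_smul (h : IsRankOneSchur r c e E F) {M : Type*} [AddCommGroup M] [Module A M]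
    [Module K M] [IsScalarTower K A M] (m : M) : E • F • E • m = c • E • m := by
  rw [h.smul_eq_sub (E • m), ← mul_smul E E, h.E_mul_E, zero_smul, smul_zero, add_zero]

/-- Each `E F e a m` is zero or a highest vector, so it lies in the sum of the simple submodules.
Since `F E = c⁻¹ F (E F) E`, so does every `F E m`, and finally `m = c⁻¹ (E F m + F E m)`. -/
theorem isSemisimpleRing (h : IsRankOneSchur r c e E F) (hc : c ≠ 0) : IsSemisimpleRing A := by
  rw [IsSemisimpleRing, ← sSup_simples_eq_top_iff_isSemisimpleModule, eq_top_iff]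
  set S : Submodule A A := sSup {m | IsSimpleModule A m}
  have h1 (a : ℕ) (m : A) : (E * F * e a) • m ∈ S := by
    by_cases hm : (E * F * e a) • m = 0
    · rw [hm]; exact S.zero_mem
    · exact le_sSup (a := Submodule.span A {(E * F * e a) • m})
        ((IsHighestVector.of_E_F h a hm).isSimpleModule_span h hc)
        (Submodule.mem_span_singleton_self _)
  have h2 (m : A) : E • F • m ∈ S := by
    rw [← h.sum_e_smul m, Finset.smul_sum, Finset.smul_sum]
    exact S.sum_mem fun a _ => by simpa only [mul_smul] using h1 a m
  have hs (x : K) (m : A) (hm : m ∈ S) : x • m ∈ S := by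
    rw [← algebraMap_smul A x m]; exact S.smul_mem _ hm
  have h3 (m : A) : F • E • m ∈ S := by
    have : F • E • m = c⁻¹ • F • (E • F • (E • m)) := by
      rw [h.E_F_E_smul, smul_comm F c, inv_smul_smul₀ hc]
    rw [this]
    exact hs _ _ (S.smul_mem F (h2 _))
  intro m _
  have : m = c⁻¹ • (E • F • m + F • E • m) := by
    rw [← h.smul_eq_sub, smul_smul, inv_mul_cancel₀ hc, one_smul]
  rw [this]
  exact hs _ _ (S.add_mem (h2 m) (h3 m))

/-- If there were none, `E F` would act as zero, hence so would `c E = E F E`, and then `c = E F + F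
E` itself. Highest weights lie in `1, …, r`, hence the shift of the index. -/
theorem exists_highestVector (h : IsRankOneSchur r c e E F) (hc : c ≠ 0) {M : Type*}
    [AddCommGroup M] [Module A M] [Nontrivial M] :
    ∃ i : Fin r, ∃ m : M, IsHighestVector e E (i + 1) m := by
  let _ : Module K M := Module.compHom M (algebraMap K A)
  have : IsScalarTower K A M := ⟨fun k x m => by
    rw [Algebra.smul_def, mul_smul]; rfl⟩
  obtain ⟨m, hm⟩ := exists_ne (0 : M)
  by_contra! hcon
  have h0 (a : ℕ) (m : M) : (E * F * e a) • m = 0 := by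
    by_contra hne
    have hv := IsHighestVector.of_E_F h a hne
    have h1 := hv.weight_le h
    have h2 := hv.weight_pos h hc
    refine hcon ⟨a - 1, by omega⟩ _ (by rwa [show a - 1 + 1 = a by omega])
  have h1 (m : M) : E • F • m = 0 := by
    rw [← h.sum_e_smul m, Finset.smul_sum, Finset.smul_sum]
    exact Finset.sum_eq_zero fun a _ => by simpa only [mul_smul] using h0 a m
  have h2 : E • m = 0 := by
    have := h.E_F_E_smul m
    rw [h1, eq_comm, smul_eq_zero] at this
    exact this.resolve_left hc
  have := h.smul_eq_sub m
  rw [h1, h2, smul_zero, add_zero, smul_eq_zero] at this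
  exact this.elim hc hm

/-- The element `c⁻¹ E F e (i + 1)` is idempotent, and it is nonzero because multiplying it by `F`
gives `F e (i + 1)`. A simple module on which it does not vanish contains a highest vector of weight
`i + 1`. -/
theorem exists_simple_highestVector (h : IsRankOneSchur r c e E F) (hc : c ≠ 0) (i : Fin r) :
    ∃ (L : Type u) (_ : AddCommGroup L) (_ : Module A L), IsSimpleModule A L ∧
      ∃ m : L, IsHighestVector e E (i + 1) m := by
  have hEFE : E * F * E = c • E := by
    have := h.E_F_E_smul (1 : A)
    simpa [mul_assoc] using this
  have hF : F * e (i + 1) ≠ 0 := fun h0 => by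
    obtain ⟨f, hf⟩ := h.exists_coord_F i i.2
    rw [h0, map_zero] at hf
    exact zero_ne_one hf
  have hFEF : F * (E * F) = c • F := by
    have := congrArg (F * ·) h.anticomm
    simp only [mul_add, ← Algebra.commutes] at this
    rw [← mul_assoc F F, h.F_mul_F, zero_mul, add_zero, ← Algebra.smul_def] at this
    exact this
  obtain ⟨L, i1, i2, hL, l, hl⟩ := exists_simple_of_idempotent
    (f := c⁻¹ • (E * F * e (i + 1))) (by
      have : E * F * e (i + 1) * (E * F * e (i + 1)) = c • (E * F * e (i + 1)) := by
        rw [mul_assoc (E * F), ← mul_assoc (e _), ← h.E_F_mul_e, mul_assoc (E * F) (e _), h.e_mul_e,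
          if_pos rfl, ← mul_assoc, ← mul_assoc, hEFE, smul_mul_assoc, smul_mul_assoc]
      rw [smul_mul_smul_comm, this, smul_smul, mul_assoc, inv_mul_cancel₀ hc, mul_one])
    (by
      intro h0
      rw [smul_eq_zero] at h0
      have h1 := h0.resolve_left (inv_ne_zero hc)
      have h2 : F * (E * F) * e (i + 1) = 0 := by rw [mul_assoc, h1, mul_zero]
      rw [hFEF, smul_mul_assoc, smul_eq_zero] at h2
      exact h2.elim hc hF)
  let _ : Module K L := Module.compHom L (algebraMap K A)
  have : IsScalarTower K A L := ⟨fun k x m => by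
    rw [Algebra.smul_def, mul_smul]; rfl⟩
  refine ⟨L, i1, i2, hL, _, IsHighestVector.of_E_F h (i + 1) (m := l) fun h0 => hl ?_⟩
  rw [smul_assoc, h0, smul_zero]

theorem hasExactlySimples_two (h : IsRankOneSchur r c e E F) (hc : c ≠ 0) :
    HasExactlySimples.{_, u, w} K A r 2 := by
  choose L i1 i2 hL m hm using h.exists_simple_highestVector hc
  refine ⟨L, i1, i2, hL, fun i => ?_, fun i j hij => ⟨fun f => hij ?_⟩, fun M _ _ _ => ?_⟩
  · let _ : Module K (L i) := Module.compHom (L i) (algebraMap K A)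
    have : IsScalarTower K A (L i) := ⟨fun k x m => by
      rw [Algebra.smul_def, mul_smul]; rfl⟩
    exact (hm i).finrank_eq_two h hc
  · let _ : Module K (L j) := Module.compHom (L j) (algebraMap K A)
    have : IsScalarTower K A (L j) := ⟨fun k x m => by
      rw [Algebra.smul_def, mul_smul]; rfl⟩
    have hfm : IsHighestVector e E (i + 1) (f (m i)) :=
      ⟨by simpa using (hm i).ne_zero, by rw [← map_smul, (hm i).e_smul],
        by rw [← map_smul, (hm i).E_smul, map_zero]⟩
    have := hfm.weight_eq (hm j) h hc
    exact Fin.ext (by omega)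
  · have := IsSimpleModule.nontrivial A M
    obtain ⟨i, n, hn⟩ := h.exists_highestVector hc (M := M)
    let _ : Module K M := Module.compHom M (algebraMap K A)
    have : IsScalarTower K A M := ⟨fun k x m => by
      rw [Algebra.smul_def, mul_smul]; rfl⟩
    let _ : Module K (L i) := Module.compHom (L i) (algebraMap K A)
    have : IsScalarTower K A (L i) := ⟨fun k x m => by
      rw [Algebra.smul_def, mul_smul]; rfl⟩
    exact ⟨i, hn.nonempty_equiv (hm i) h hc⟩

end Semisimple

/-! ### ### The non-semisimple case: zero central element -/

section NotSemisimple

variable {K : Type*} {A : Type u} [Field K] [Ring A] [Algebra K A] {r : ℕ} {e : ℕ → A}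
  {E F : A}

theorem smul_eq_of_killed (h : IsRankOneSchur r (0 : K) e E F) {M : Type*} [AddCommGroup M]
    [Module A M] [Module K M] [IsScalarTower K A M] {a : ℕ} {m : M}
    (hm : IsHighestVector e E a m) (hF : F • m = 0) (α β γ δ : ℕ → K) :
    (∑ b ∈ Finset.range (r + 1), (α b • e b + β b • (E * e b) + γ b • (F * e b) +
      δ b • (E * F * e b))) • m = α a • m := by
  rw [hm.smul_eq h, hF, smul_zero, add_zero, zero_mul, add_zero]

theorem exists_smul_eq_of_killed (h : IsRankOneSchur r (0 : K) e E F) {M : Type*} [AddCommGroup M]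
    [Module A M] [Module K M] [IsScalarTower K A M] [IsSimpleModule A M] {a : ℕ} {m : M}
    (hm : IsHighestVector e E a m) (hF : F • m = 0) (y : M) : ∃ α : K, α • m = y := by
  obtain ⟨x, rfl⟩ := IsSimpleModule.toSpanSingleton_surjective A hm.ne_zero y
  obtain ⟨α, β, γ, δ, rfl⟩ := h.exists_eq_sum x
  exact ⟨α a, (h.smul_eq_of_killed hm hF α β γ δ).symm⟩

/-- With `c = 0` the operators `E` and `F` anticommute and square to zero. Any nonzero value of `E
F` is killed by both; if `E F` vanishes, any nonzero value of `F` will do, then of `E`, and finally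
any nonzero vector. A weight component of the vector found is still killed. -/
theorem exists_killed (h : IsRankOneSchur r (0 : K) e E F) {M : Type*} [AddCommGroup M]
    [Module A M] [Nontrivial M] : ∃ a : ℕ, ∃ m : M, IsHighestVector e E a m ∧ F • m = 0 := by
  have hEF : E * F = -(F * E) := eq_neg_of_add_eq_zero_left (by rw [h.anticomm, map_zero])
  have hFEF : F * (E * F) = 0 := by rw [hEF, mul_neg, ← mul_assoc, h.F_mul_F, zero_mul, neg_zero]
  have hEEF : E * (E * F) = 0 := by rw [← mul_assoc, h.E_mul_E, zero_mul]
  obtain ⟨n, hn, hE, hF⟩ : ∃ n : M, n ≠ 0 ∧ E • n = 0 ∧ F • n = 0 := by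
    by_cases h1 : ∃ m : M, (E * F) • m ≠ 0
    · obtain ⟨m, hm⟩ := h1
      exact ⟨_, hm, by rw [← mul_smul, hEEF, zero_smul], by rw [← mul_smul, hFEF, zero_smul]⟩
    push Not at h1
    by_cases h2 : ∃ m : M, F • m ≠ 0
    · obtain ⟨m, hm⟩ := h2
      exact ⟨_, hm, by rw [← mul_smul, h1], by rw [← mul_smul, h.F_mul_F, zero_smul]⟩
    push Not at h2
    by_cases h3 : ∃ m : M, E • m ≠ 0
    · obtain ⟨m, hm⟩ := h3
      exact ⟨_, hm, by rw [← mul_smul, h.E_mul_E, zero_smul], h2 _⟩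
    push Not at h3
    obtain ⟨m, hm⟩ := exists_ne (0 : M)
    exact ⟨m, hm, h3 m, h2 m⟩
  obtain ⟨a, ha⟩ : ∃ a, e a • n ≠ 0 := by
    by_contra! h0
    rw [← h.sum_e_smul n, Finset.sum_eq_zero fun a _ => h0 a] at hn
    exact hn rfl
  refine ⟨a, e a • n, ⟨ha, ?_, ?_⟩, ?_⟩
  · rw [← mul_smul, h.e_mul_e, if_pos rfl]
  · rw [← mul_smul, ← h.e_mul_E, mul_smul, hE, smul_zero]
  · cases a with
    | zero => rw [← mul_smul, h.F_mul_e_zero, zero_smul]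
    | succ a => rw [← mul_smul, ← h.e_mul_F, mul_smul, hF, smul_zero]

theorem e_smul_eq_zero_of_killed (h : IsRankOneSchur r (0 : K) e E F) {M : Type*} [AddCommGroup M]
    [Module A M] [IsSimpleModule A M] {a b : ℕ} {m : M}
    (hm : IsHighestVector e E a m) (hF : F • m = 0) (hab : b ≠ a) (y : M) : e b • y = 0 := by
  let _ : Module K M := Module.compHom M (algebraMap K A)
  have : IsScalarTower K A M := ⟨fun k x m => by
    rw [Algebra.smul_def, mul_smul]; rfl⟩
  obtain ⟨α, rfl⟩ := h.exists_smul_eq_of_killed hm hF y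
  rw [smul_comm (e b), hm.e_smul_eq h, if_neg hab, smul_zero]

theorem F_smul_eq_zero (h : IsRankOneSchur r (0 : K) e E F) {M : Type*} [AddCommGroup M]
    [Module A M] [IsSimpleModule A M] (y : M) : F • y = 0 := by
  let _ : Module K M := Module.compHom M (algebraMap K A)
  have : IsScalarTower K A M := ⟨fun k x m => by
    rw [Algebra.smul_def, mul_smul]; rfl⟩
  have := IsSimpleModule.nontrivial A M
  obtain ⟨a, m, hm, hF⟩ := h.exists_killed (M := M)
  obtain ⟨α, rfl⟩ := h.exists_smul_eq_of_killed hm hF y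
  rw [smul_comm F, hF, smul_zero]

/-- `F` kills every simple module, so it would kill the regular module if that were a sum of simple
ones. But `F * e 1` is nonzero, since `r` is positive. -/
theorem not_isSemisimpleRing (h : IsRankOneSchur r (0 : K) e E F) (hr : 0 < r) :
    ¬ IsSemisimpleRing A := by
  intro hA
  have htop : sSup {m : Submodule A A | IsSimpleModule A m} = ⊤ :=
    sSup_simples_eq_top_iff_isSemisimpleModule.2 hA
  have h1 : (1 : A) ∈ sSup {m : Submodule A A | IsSimpleModule A m} := by rw [htop]; trivial
  have key : F * 1 = 0 := by
    rw [sSup_eq_iSup'] at h1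
    generalize (1 : A) = y at h1 ⊢
    induction h1 using Submodule.iSup_induction' with
    | mem N x hx =>
      have : IsSimpleModule A N.1 := N.2
      exact congrArg Subtype.val (h.F_smul_eq_zero (⟨x, hx⟩ : N.1))
    | zero => exact mul_zero F
    | add x y _ _ hx hy => rw [mul_add, hx, hy, add_zero]
  obtain ⟨f, hf⟩ := h.exists_coord_F 0 hr
  rw [mul_one] at key
  rw [key, zero_mul, map_zero] at hf
  exact zero_ne_one hf

/-- A simple module on which `e i` is nonzero is a single weight line, so its weight must be `i`. -/
theorem exists_simple_killed (h : IsRankOneSchur r (0 : K) e E F) (i : Fin (r + 1)) :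
    ∃ (L : Type u) (_ : AddCommGroup L) (_ : Module A L), IsSimpleModule A L ∧
      ∃ m : L, IsHighestVector e E i m ∧ F • m = 0 := by
  obtain ⟨L, i1, i2, hL, l, hl⟩ := exists_simple_of_idempotent (f := e i)
    (by rw [h.e_mul_e, if_pos rfl]) (fun h0 => by
      obtain ⟨f, hf⟩ := h.exists_coord_e i (by omega)
      rw [h0, map_zero] at hf
      exact zero_ne_one hf)
  have := IsSimpleModule.nontrivial A L
  obtain ⟨a, m, hm, hF⟩ := h.exists_killed (M := L)
  have hai : (i : ℕ) = a := by
    by_contra hne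
    exact hl (h.e_smul_eq_zero_of_killed hm hF hne l)
  exact ⟨L, i1, i2, hL, m, by rwa [hai], hF⟩

theorem hasExactlySimples_one (h : IsRankOneSchur r (0 : K) e E F) :
    HasExactlySimples.{_, u, w} K A (r + 1) 1 := by
  choose L i1 i2 hL m hm hmF using h.exists_simple_killed
  refine ⟨L, i1, i2, hL, fun i => ?_, fun i j hij => ⟨fun f => ?_⟩, fun M _ _ _ => ?_⟩
  · let _ : Module K (L i) := Module.compHom (L i) (algebraMap K A)
    have : IsScalarTower K A (L i) := ⟨fun k x m => by
      rw [Algebra.smul_def, mul_smul]; rfl⟩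
    have h1 : Module.finrank K (L i) = 1 := finrank_eq_one_iff'.2
      ⟨m i, (hm i).ne_zero, h.exists_smul_eq_of_killed (hm i) (hmF i)⟩
    exact h1
  · refine (hm i).ne_zero (f.injective ?_)
    rw [map_zero, ← (hm i).e_smul, map_smul]
    exact h.e_smul_eq_zero_of_killed (hm j) (hmF j) (fun hv => hij (Fin.ext hv)) _
  · have := IsSimpleModule.nontrivial A M
    obtain ⟨a, n, hn, hnF⟩ := h.exists_killed (M := M)
    obtain ⟨i, rfl⟩ : ∃ i : Fin (r + 1), (i : ℕ) = a :=
      ⟨⟨a, Nat.lt_succ_of_le (hn.weight_le h)⟩, rfl⟩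
    let _ : Module K M := Module.compHom M (algebraMap K A)
    have : IsScalarTower K A M := ⟨fun k x m => by
      rw [Algebra.smul_def, mul_smul]; rfl⟩
    let _ : Module K (L i) := Module.compHom (L i) (algebraMap K A)
    have : IsScalarTower K A (L i) := ⟨fun k x m => by
      rw [Algebra.smul_def, mul_smul]; rfl⟩
    refine ⟨i, nonempty_equiv_of_annihilator_le hn.ne_zero (hm i).ne_zero fun x hx => ?_⟩
    obtain ⟨α, β, γ, δ, rfl⟩ := h.exists_eq_sum x
    rw [h.smul_eq_of_killed hn hnF, smul_eq_zero] at hx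
    rw [h.smul_eq_of_killed (hm i) (hmF i), hx.resolve_right hn.ne_zero, zero_smul]

end NotSemisimple

end IsRankOneSchur

/-! ### The `q`-Schur superalgebras of `gl(1|1)` -/

theorem exists_isRankOneSchur_schurEnd {R : Type*} [CommRing R] (q : Rˣ) (r : ℕ)
    (hq : 1 + (q : R) ∈ nonZeroDivisors R) :
    ∃ (e : ℕ → SchurEnd 1 1 r R q) (E F : SchurEnd 1 1 r R q),
      IsRankOneSchur r (∑ i ∈ Finset.range r, ((q⁻¹ ^ i : Rˣ) : R)) e E F :=
  ⟨_, _, _, (isRankOneSchur_fockCommutant q hq).map (schurEndEquiv r R q).symm⟩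

theorem one_add_genericParam_sq_mem_nonZeroDivisors :
    1 + ((genericParam ^ 2 : GenericRingˣ) : GenericRing) ∈ nonZeroDivisors GenericRing := by
  refine mem_nonZeroDivisors_of_ne_zero fun h => ?_
  -- Specialising `υ` to `1` in `ℤ` sends `1 + υ²` to `2`, which is not zero.
  have := congrArg (specialize (1 : ℤˣ)) h
  rw [map_add, map_one, Units.val_pow_eq_pow_val, map_pow, specialize_genericParam, map_zero] at this
  norm_num at this

/-- No condition on `v` is needed: regularity of `1 + q` is used only over the generic ring, before
the base change. -/
theorem exists_isRankOneSchur_schurSuper {K : Type*} [Field K] (v : Kˣ) (r : ℕ) :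
    ∃ (e : ℕ → SchurSuper 1 1 r v) (E F : SchurSuper 1 1 r v),
      IsRankOneSchur r (∑ i ∈ Finset.range r, (((v : K) ^ 2)⁻¹) ^ i) e E F := by
  obtain ⟨e, E, F, h⟩ := exists_isRankOneSchur_schurEnd (genericParam ^ 2) r
    one_add_genericParam_sq_mem_nonZeroDivisors
  have hc : specialize v (∑ i ∈ Finset.range r,
      (((genericParam ^ 2)⁻¹ ^ i : GenericRingˣ) : GenericRing)) =
      ∑ i ∈ Finset.range r, (((v : K) ^ 2)⁻¹) ^ i := by
    rw [map_sum]
    refine Finset.sum_congr rfl fun i _ => ?_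
    have hu : Units.map (specialize v).toMonoidHom genericParam = v :=
      Units.ext (specialize_genericParam v)
    have h1 : Units.map (specialize v).toMonoidHom ((genericParam ^ 2)⁻¹ ^ i) = (v ^ 2)⁻¹ ^ i := by
      rw [map_pow, map_inv, map_pow, hu]
    simpa using congrArg Units.val h1
  rw [← hc]
  exact ⟨_, _, _, h.baseChange (SpecializedRing v)⟩

theorem sum_inv_pow_eq_zero_iff {K : Type*} [Field K] {q : K} {l : ℕ} (hq : q ≠ 1)
    (hprim : IsPrimitiveRoot q l) (r : ℕ) : ∑ i ∈ Finset.range r, q⁻¹ ^ i = 0 ↔ l ∣ r := by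
  have hq' : q⁻¹ ≠ 1 := by simpa using hq
  rw [geom_sum_eq hq', div_eq_zero_iff, or_iff_left (sub_ne_zero.2 hq'), sub_eq_zero, inv_pow,
    inv_eq_one, hprim.pow_eq_one_iff_dvd]

namespace IsRankOneSchur

variable {K : Type*} {A : Type u} [Field K] [Ring A] [Algebra K A] {r : ℕ} {e : ℕ → A} {E F : A}

theorem dichotomy {c : K} (h : IsRankOneSchur r c e E F) (hr : 0 < r) {p : Prop}
    (hp : c = 0 ↔ p) :
    (¬ p → IsSemisimpleRing A ∧ HasExactlySimples.{_, u, w} K A r 2) ∧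
      (p → ¬ IsSemisimpleRing A ∧ HasExactlySimples.{_, u, w} K A (r + 1) 1) := by
  refine ⟨fun hn => ?_, fun hy => ?_⟩
  · have hc : c ≠ 0 := fun h0 => hn (hp.1 h0)
    exact ⟨h.isSemisimpleRing hc, h.hasExactlySimples_two hc⟩
  · obtain rfl := hp.2 hy
    exact ⟨h.not_isSemisimpleRing hr, h.hasExactlySimples_one⟩

end IsRankOneSchur

end QSchur

end

theorem mainTheorem8 {F : Type u} [Field F] (hchar : ringChar F ≠ 2) (v : Fˣ) (l r : ℕ)
    (hl : 0 < l) (hr : 0 < r) (hq : (v : F) ^ 2 ≠ 1) (hprim : IsPrimitiveRoot ((v : F) ^ 2) l) :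
    ((¬ l ∣ r → IsSemisimpleRing (QSchur.SchurSuper 1 1 r v) ∧
        QSchur.HasExactlySimples.{u, u, w} F (QSchur.SchurSuper 1 1 r v) r 2) ∧
      (l ∣ r → ¬ IsSemisimpleRing (QSchur.SchurSuper 1 1 r v) ∧
        QSchur.HasExactlySimples.{u, u, w} F (QSchur.SchurSuper 1 1 r v) (r + 1) 1)) ∧
    ((v : F) ^ 2 ≠ -1 →
      (¬ l ∣ r → IsSemisimpleRing (QSchur.SchurEnd 1 1 r F (v ^ 2)) ∧
        QSchur.HasExactlySimples.{u, u, w} F (QSchur.SchurEnd 1 1 r F (v ^ 2)) r 2) ∧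
      (l ∣ r → ¬ IsSemisimpleRing (QSchur.SchurEnd 1 1 r F (v ^ 2)) ∧
        QSchur.HasExactlySimples.{u, u, w} F (QSchur.SchurEnd 1 1 r F (v ^ 2)) (r + 1) 1)) := by
  have hc := QSchur.sum_inv_pow_eq_zero_iff hq hprim r
  refine ⟨?_, fun hne => ?_⟩
  · obtain ⟨e, E, F', h⟩ := QSchur.exists_isRankOneSchur_schurSuper v r
    exact h.dichotomy hr hc
  · obtain ⟨e, E, F', h⟩ := QSchur.exists_isRankOneSchur_schurEnd (v ^ 2) r
      -- Over the field itself, regularity of `1 + q` is exactly the condition `q ≠ -1`.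
      (mem_nonZeroDivisors_of_ne_zero fun h0 => hne (by
        rw [Units.val_pow_eq_pow_val] at h0
        exact eq_neg_of_add_eq_zero_right h0))
    refine h.dichotomy hr ?_
    rw [← hc]
    simp
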